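/- Let $\mathrm{Homeo}_+(\mathbb S^1)$ be the group of orientation preserving homeomorphisms of the circle $\mathbb S^1$. A group $\Gamma$ of homeomorphisms of a space $X$ is topologically transitive if for all nonempty open $U,V\subseteq X$ there is $g\in \Gamma$ with $g(U)\cap V\neq\emptyset$; it is tightly transitive if it is topologically transitive and no subgroup of $\Gamma$ of infinite index is topologically transitive; it is almost minimal if at most countably many points of $X$ are nontransitive, that is, have a $\Gamma$-orbit that is not dense in $X$. Proposition 5.1 (with Corollary 5.2). Let $n\ge 2$ and let $G\le \mathrm{Homeo}_+(\mathbb S^1)$ be a tightly transitive and almost minimal subgroup that is isomorphic to $\mathbb Z^n$. Let $\{x_1,\dots,x_k\}$, $k\ge 1$, be a finite $G$-orbit with $k$ elements, where $x_1,\dots,x_k$ are listed in anticlockwise order on $\mathbb S^1$, and put $x_{k+1}=x_1$. Let $$H=\{g\in G:\ g(x_i)=x_i,\ 1\le i\le k\}.$$ Then $H$ is normal in $G$ and $G/H\cong\mathbb Z/k\mathbb Z$. Moreover, every element of $H$ maps the open arc $(x_1,x_2)$, running anticlockwise from $x_1$ to $x_2$ (if $k=1$ this is $\mathbb S^1\setminus\{x_1\}$),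 onto itself, and the restriction $H|_{(x_1,x_2)}$, as a group of homeomorphisms of this arc, is tightly transitive and almost minimal. Finally, $\{x_1,\dots,x_k\}$ is the unique finite $G$-orbit. -/

import Mathlib

namespace CircleGroups

/-- `Homeo₊(𝕊¹)`, with the circle modelled as `ℝ / ℤ`: the homeomorphisms that preserve the cyclic
order (`sbtw a b c` says that `a, b, c` are distinct and met in this order when running
anticlockwise, i.e. in the positive direction). -/
def homeoPlus : Subgroup (UnitAddCircle ≃ₜ UnitAddCircle) where
  carrier := {f | ∀ a b c, sbtw (f a) (f b) (f c) ↔ sbtw a b c}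
  one_mem' := fun _ _ _ => Iff.rfl
  mul_mem' := fun {f g} hf hg a b c => (hf (g a) (g b) (g c)).trans (hg a b c)
  inv_mem' := fun {f} hf a b c => by
    have h := hf (f.symm a) (f.symm b) (f.symm c)
    simp only [Homeomorph.apply_symm_apply] at h
    exact h.symm

/-- The open arc `(a, b)` of the circle running anticlockwise from `a` to `b`. As `btw a x a` always
holds, `(a, a)` is the whole circle without the point `a`. -/
def openArc (a b : UnitAddCircle) : Set UnitAddCircle :=
  {x | x ≠ a ∧ x ≠ b ∧ btw a x b}

/-- The points `x 0, …, x (k - 1)` are distinct and lie on the circle in anticlockwise order. -/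
def IsAnticlockwise {k : ℕ} (x : Fin k → UnitAddCircle) : Prop :=
  Function.Injective x ∧ ∀ i j l : Fin k, i < j → j < l → sbtw (x i) (x j) (x l)

section General

variable {X : Type*} [TopologicalSpace X]

/-- The tautological action of the homeomorphism group of `X` on `X`. -/
instance homeoAction : MulAction (X ≃ₜ X) X where
  smul f x := f x
  one_smul _ := rfl
  mul_smul _ _ _ := rfl

/-- `G` is topologically transitive and no subgroup of `G` of infinite index is
(`F.relIndex G` is the index `[G : F]`, with value `0` exactly when the index is infinite). -/
def IsTightlyTransitive (G : Subgroup (X ≃ₜ X)) : Prop :=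
  MulAction.IsTopologicallyTransitive G X ∧
    ∀ F : Subgroup (X ≃ₜ X), F ≤ G → F.relIndex G = 0 → ¬ MulAction.IsTopologicallyTransitive F X

/-- At most countably many points are nontransitive, i.e. have an orbit that is not dense. -/
def IsAlmostMinimal (G : Subgroup (X ≃ₜ X)) : Prop :=
  {x : X | ¬ Dense (MulAction.orbit G x)}.Countable

/-- The subgroup of those elements of `G` that fix every point of `S`. -/
def pointwiseStabilizer (G : Subgroup (X ≃ₜ X)) (S : Set X) : Subgroup (X ≃ₜ X) :=
  G ⊓ fixingSubgroup (X ≃ₜ X) S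

/-- The restriction `H|_A`: the group of homeomorphisms of `A` that are restrictions of
elements of `H` (necessarily of elements that map `A` onto itself). -/
def restriction (H : Subgroup (X ≃ₜ X)) (A : Set X) : Subgroup (A ≃ₜ A) where
  carrier := {φ | ∃ h ∈ H, ∀ a : A, (φ a : X) = h (a : X)}
  one_mem' := ⟨1, H.one_mem, fun _ => rfl⟩
  mul_mem' := by
    rintro φ ψ ⟨h, hh, hφ⟩ ⟨g, hg, hψ⟩
    refine ⟨h * g, H.mul_mem hh hg, fun a => ?_⟩
    exact (hφ (ψ a)).trans (congrArg h (hψ a))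
  inv_mem' := by
    rintro φ ⟨h, hh, hφ⟩
    refine ⟨h⁻¹, H.inv_mem hh, fun a => ?_⟩
    have e := hφ (φ.symm a)
    rw [Homeomorph.apply_symm_apply] at e
    exact ((Homeomorph.symm_apply_eq h).2 e).symm

end General

end CircleGroups

open Module

namespace CircleGroups

/-! ### Commuting order-preserving maps of a dense linear order -/

section LineActions

variable {Ω V : Type*} [LinearOrder Ω] [AddCommGroup V] [AddAction V Ω]

/-! `G` is abelian and transitive on the finite orbit, so an element fixing `x 0` fixes the whole
orbit: `H` is the stabilizer of `x 0`. Preservation of cyclic order makes an element `g` with `g (x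
0) = x 1` rotate the orbit by one place, so `G / H` is cyclic of order `k`. The elements of `G`
permute the arcs between consecutive orbit points, hence one that returns a point of the first arc
to that arc lies in `H`. Topological transitivity and almost minimality pass to the arc by this
remark. A second finite orbit would meet the arc in a finite set with a largest point, which some
order-preserving return map would push further up (`not_finite_invariant`).

The real content is tightness. Suppose `F` has infinite index in `H` and is transitive on the arc.
The group generated by `F` and `g` is transitive on the circle but may have finite index in `G`,
because `k • g` need not lie in `F`. So `F` is replaced by a more economical group. By descent on
rank there is a wandering interval `J` whose stabilizer `S` in `H` acts freely
(`exists_isWandering_free`). By a Hölder-type argument `S` is Archimedean ordered, and any two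
independent elements of `S` already generate a group transitive on the intervals of `J`
(`transOn_of_indep`). Since a cyclic group is never transitive, `F ⊓ S` has rank at least 2; and `F`
maps onto `H / S`. Thus `rank (H / S) + 2 ≤ rank F < rank H`.

Now let `L` be generated by lifts of a basis of `H / S`, by `g + h` and by `b`, with `h` and `b` in
`S`. Modulo the lifts, `k • (g + h)` is an element of `S`, and `h` can be chosen so that it is
independent of `b` (`exists_index_eq_zero`). Then `L` has rank too small for finite index, `L + S`
is everything, and `L ⊓ S` is transitive on `J`; hence `L` is transitive on the circle, against the
tightness of `G`. -/

/-- `F` is transitive on the open intervals with endpoints in `J`. -/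
def TransOn (F : AddSubgroup V) (J : Set Ω) : Prop :=
  ∀ ⦃a b c d : Ω⦄, a ∈ J → b ∈ J → c ∈ J → d ∈ J → a < b → c < d →
    ∃ v ∈ F, ∃ x, a < x ∧ x < b ∧ c < v +ᵥ x ∧ v +ᵥ x < d

/-- An interval without endpoints whose translates coincide with it or are disjoint from it. -/
structure IsWandering (V : Type*) [AddCommGroup V] [AddAction V Ω] (J : Set Ω) : Prop where
  conn : J.OrdConnected
  ne : J.Nonempty
  noMin : ∀ x ∈ J, ∃ y ∈ J, y < x
  noMax : ∀ x ∈ J, ∃ y ∈ J, x < y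
  wand : ∀ (v : V) (x : Ω), x ∈ J → v +ᵥ x ∈ J → ∀ y ∈ J, v +ᵥ y ∈ J

/-- The stabilizer of a set. -/
def stab (V : Type*) [AddCommGroup V] [AddAction V Ω] (J : Set Ω) : AddSubgroup V where
  carrier := {v | ∀ y, v +ᵥ y ∈ J ↔ y ∈ J}
  zero_mem' y := by simp
  add_mem' {u v} hu hv y := by rw [add_vadd, hu, hv]
  neg_mem' {v} hv y := by rw [← hv, vadd_neg_vadd]

theorem IsWandering.mem_stab {J : Set Ω} (hJ : IsWandering V J) {v : V} {x : Ω} (hx : x ∈ J)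
    (hv : v +ᵥ x ∈ J) : v ∈ stab V J := by
  refine fun y => ⟨fun h => ?_, hJ.wand v x hx hv y⟩
  have := hJ.wand (-v) (v +ᵥ x) hv (by simpa) (v +ᵥ y) h
  simpa using this

theorem isWandering_univ [NoMinOrder Ω] [NoMaxOrder Ω] [Nonempty Ω] :
    IsWandering V (Set.univ : Set Ω) where
  conn := Set.ordConnected_univ
  ne := Set.univ_nonempty
  noMin x _ := by simpa using exists_lt x
  noMax x _ := by simpa using exists_gt x
  wand := by simp

theorem IsWandering.transOn_inf {J : Set Ω} (hJ : IsWandering V J) {F : AddSubgroup V}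
    (hF : TransOn F (Set.univ : Set Ω)) : TransOn (F ⊓ stab V J) J := by
  intro a b c d ha hb hc hd hab hcd
  obtain ⟨v, hv, x, h1, h2, h3, h4⟩ := hF (Set.mem_univ a) (Set.mem_univ b) (Set.mem_univ c)
    (Set.mem_univ d) hab hcd
  exact ⟨v, ⟨hv, hJ.mem_stab (hJ.conn.out ha hb ⟨h1.le, h2.le⟩)
    (hJ.conn.out hc hd ⟨h3.le, h4.le⟩)⟩, x, h1, h2, h3, h4⟩

theorem TransOn.mono {F F' : AddSubgroup V} {J : Set Ω} (hF : TransOn F J) (h : F ≤ F') :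
    TransOn F' J := fun _ _ _ _ ha hb hc hd hab hcd =>
  let ⟨v, hv, x⟩ := hF ha hb hc hd hab hcd
  ⟨v, h hv, x⟩

variable (hm : ∀ v : V, StrictMono fun x : Ω => v +ᵥ x)
include hm

theorem le_nsmul_vadd {v : V} {x : Ω} (h : x ≤ v +ᵥ x) (n : ℕ) : x ≤ n • v +ᵥ x := by
  induction n with
  | zero => simp
  | succ n ih =>
    rw [succ_nsmul, add_vadd]
    exact ih.trans ((hm (n • v)).monotone h)

theorem IsWandering.mem_of_le {J : Set Ω} (hJ : IsWandering V J) {v : V} {n : ℕ} (hn : n ≠ 0)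
    (hv : n • v ∈ stab V J) {x : Ω} (hx : x ∈ J) (h : x ≤ v +ᵥ x) : v ∈ stab V J := by
  obtain ⟨n, rfl⟩ := Nat.exists_eq_succ_of_ne_zero hn
  refine hJ.mem_stab hx (hJ.conn.out hx ((hv x).2 hx) ⟨h, ?_⟩)
  rw [Nat.succ_eq_add_one, succ_nsmul', add_vadd]
  exact (hm v).monotone (le_nsmul_vadd hm h n)

/-- By monotonicity `v +ᵥ x` lies between `x` and `n • v +ᵥ x`, both in the convex set `J`. Purity
makes quotients by stabilizers torsion-free, so that ranks detect strict inclusions. -/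
theorem IsWandering.pure {J : Set Ω} (hJ : IsWandering V J) {v : V} {c : ℤ} (hc : c ≠ 0)
    (hv : c • v ∈ stab V J) : v ∈ stab V J := by
  have hn : c.natAbs ≠ 0 := by simpa using hc
  have hv' : c.natAbs • v ∈ stab V J := by
    rw [← natCast_zsmul, Int.natCast_natAbs]
    rcases abs_choice c with h | h <;> rw [h]
    · exact hv
    · rw [neg_smul]; exact neg_mem hv
  obtain ⟨x, hx⟩ := hJ.ne
  rcases le_total x (v +ᵥ x) with h | h
  · exact hJ.mem_of_le hm hn hv' hx h
  · rw [← neg_mem_iff]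
    refine hJ.mem_of_le hm hn (by rw [smul_neg]; exact neg_mem hv') hx ?_
    simpa using (hm (-v)).monotone h

/-- Some `f ∈ F` carries a point of `J` into the translate `v +ᵥ J`, so `f` and `v` differ by a
return to `J`. -/
theorem IsWandering.sup_eq_top {J : Set Ω} (hJ : IsWandering V J) {F : AddSubgroup V}
    (hF : TransOn F (Set.univ : Set Ω)) : F ⊔ stab V J = ⊤ := by
  rw [eq_top_iff]
  intro v _
  obtain ⟨x, hx⟩ := hJ.ne
  obtain ⟨y, hy, hxy⟩ := hJ.noMax x hx
  obtain ⟨f, hf, z, h1, h2, h3, h4⟩ := hF (Set.mem_univ x) (Set.mem_univ y)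
    (Set.mem_univ (v +ᵥ x)) (Set.mem_univ (v +ᵥ y)) hxy (hm v hxy)
  have hz := hJ.conn.out hx hy ⟨h1.le, h2.le⟩
  have hs : f - v ∈ stab V J := by
    refine hJ.mem_stab hz (hJ.conn.out hx hy ?_)
    have e : (f - v) +ᵥ z = -v +ᵥ (f +ᵥ z) := by rw [← add_vadd]; congr 1; abel
    rw [e]
    constructor
    · simpa using ((hm (-v)) h3).le
    · simpa using ((hm (-v)) h4).le
  have e : v = f + -(f - v) := by abel
  rw [e]
  exact add_mem (AddSubgroup.mem_sup_left hf) (AddSubgroup.mem_sup_right (neg_mem hs))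

/-- A cyclic group is not transitive on intervals. -/
theorem not_transOn_of_cyclic [DenselyOrdered Ω] {J : Set Ω} (hJ : IsWandering V J)
    {F : AddSubgroup V} (hF : F ≤ stab V J) {v : V} (hvF : v ∈ F)
    (hv : ∀ w ∈ F, ∃ c : ℤ, c • v = w) : ¬ TransOn F J := by
  intro hT
  obtain ⟨x, hx⟩ := hJ.ne
  have key : ∀ v : V, v ∈ F → (∀ w ∈ F, ∃ c : ℤ, c • v = w) → ¬ x < v +ᵥ x := by
    intro v hvF hv hlt
    have hvx := (hF hvF x).2 hx
    obtain ⟨e, he1, he2⟩ := exists_between hlt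
    have he := hJ.conn.out hx hvx ⟨he1.le, he2.le⟩
    -- The intervals `(x, e)` and `(e, v +ᵥ x)` are disjoint parts of one fundamental domain of `v`:
    -- positive multiples of `v` overshoot it, negative ones fall below it.
    obtain ⟨w, hw, y, h1, h2, h3, h4⟩ := hT hx he he hvx he1 he2
    obtain ⟨c, rfl⟩ := hv w hw
    rcases lt_trichotomy c 0 with hc | rfl | hc
    · obtain ⟨n, rfl⟩ : ∃ n : ℕ, c = -(n + 1 : ℤ) := ⟨(-c - 1).toNat, by omega⟩
      have h5 := hm ((-(n + 1 : ℤ)) • v) (h2.trans he2)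
      simp only [← add_vadd] at h5
      have h6 := (hm (-(n • v))).monotone (le_nsmul_vadd hm hlt.le n)
      simp only [neg_vadd_vadd] at h6
      have e : (-(n + 1 : ℤ)) • v + v = -(n • v) := by
        rw [neg_smul, add_smul, natCast_zsmul, one_smul]; abel
      rw [e] at h5
      exact absurd (h3.trans h5) (by simpa using h6.trans he1.le)
    · simp only [zero_smul, zero_vadd] at h3
      exact absurd h3 h2.not_gt
    · obtain ⟨n, rfl⟩ : ∃ n : ℕ, c = (n + 1 : ℤ) := ⟨(c - 1).toNat, by omega⟩
      have e : (n + 1 : ℤ) • v = v + n • v := by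
        rw [add_smul, natCast_zsmul, one_smul]; abel
      rw [e, add_vadd] at h4
      have h5 := (hm v).lt_iff_lt.1 h4
      have h6 := (hm (n • v)) h1
      exact absurd (h6.trans h5) (le_nsmul_vadd hm hlt.le n).not_gt
  have h1 := key v hvF hv
  have h2 : ¬ v +ᵥ x < x := by
    intro h
    refine key (-v) (neg_mem hvF) (fun w hw => ?_) (by simpa using hm (-v) h)
    obtain ⟨c, hc⟩ := hv w hw
    exact ⟨-c, by simpa using hc⟩
  -- In the remaining case all of `F` fixes `x`, and nothing can cross from below `x` to above it.
  have hfix : v +ᵥ x = x := le_antisymm (not_lt.1 h1) (not_lt.1 h2)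
  have hfix' : ∀ w ∈ F, w +ᵥ x = x := by
    intro w hw
    obtain ⟨c, rfl⟩ := hv w hw
    have : v ∈ AddAction.stabilizer V x := hfix
    exact zsmul_mem this c
  obtain ⟨a, ha, hax⟩ := hJ.noMin x hx
  obtain ⟨b, hb, hxb⟩ := hJ.noMax x hx
  obtain ⟨w, hw, y, h1, h2, h3, h4⟩ := hT ha hx hx hb hax hxb
  have := hm w h2
  simp only [hfix' w hw] at this
  exact absurd this h3.not_gt

/-- A monotone map cannot move a point onto or past one of its fixed points. -/
theorem IsWandering.uIcc_subset {J : Set Ω} (hJ : IsWandering V J) {h : V} (hh : h ∈ stab V J)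
    {y : Ω} (hy : y ∈ J) (hne : h +ᵥ y ≠ y) :
    Set.uIcc y (h +ᵥ y) ⊆ J \ {z | h +ᵥ z = z} := by
  intro w hw
  refine ⟨hJ.conn.uIcc_subset hy ((hh y).2 hy) hw, fun hfix : h +ᵥ w = w => hne ?_⟩
  have hmon := (hm h).monotone
  rcases Set.mem_uIcc.1 hw with ⟨h1, h2⟩ | ⟨h1, h2⟩
  · have h3 : h +ᵥ y ≤ w := hfix ▸ hmon h1
    have h4 : w = h +ᵥ y := le_antisymm h2 h3
    rw [h4] at hfix
    exact (hm h).injective hfix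
  · have h3 : w ≤ h +ᵥ y := by
      have := hmon h2
      simp only [hfix] at this; exact this
    have h4 : w = h +ᵥ y := le_antisymm h3 h1
    rw [h4] at hfix
    exact (hm h).injective hfix

/-- A component of the complement of a fixed point set is again wandering. -/
theorem IsWandering.component {J : Set Ω} (hJ : IsWandering V J) {h : V} (hh : h ∈ stab V J)
    {x : Ω} (hx : x ∈ J) (hne : h +ᵥ x ≠ x) :
    IsWandering V (Set.ordConnectedComponent (J \ {z | h +ᵥ z = z}) x) := by
  set C := Set.ordConnectedComponent (J \ {z | h +ᵥ z = z}) x with hC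
  have hCs : C ⊆ J \ {z | h +ᵥ z = z} := Set.ordConnectedComponent_subset
  have hup : ∀ y ∈ C, h +ᵥ y ∈ C := fun y hy =>
    Set.mem_ordConnectedComponent_trans hy (hJ.uIcc_subset hm hh (hCs hy).1 (hCs hy).2)
  have hdown : ∀ y ∈ C, -h +ᵥ y ∈ C := by
    intro y hy
    refine Set.mem_ordConnectedComponent_trans hy ?_
    have h1 : h +ᵥ (-h +ᵥ y) ≠ -h +ᵥ y := by
      rw [vadd_neg_vadd]
      intro h2
      refine (hCs hy).2 ?_
      change h +ᵥ y = y
      conv_lhs => rw [h2]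
      simp
    have h3 := hJ.uIcc_subset hm hh ((neg_mem hh y).2 (hCs hy).1) h1
    rw [vadd_neg_vadd, Set.uIcc_comm] at h3
    exact h3
  refine ⟨inferInstance, ⟨x, ?_⟩, ?_, ?_, ?_⟩
  · exact Set.self_mem_ordConnectedComponent.2 ⟨hx, hne⟩
  · intro y hy
    rcases lt_or_gt_of_ne (hCs hy).2 with h1 | h1
    · exact ⟨_, hup y hy, h1⟩
    · exact ⟨_, hdown y hy, by simpa using hm (-h) h1⟩
  · intro y hy
    rcases lt_or_gt_of_ne (hCs hy).2 with h1 | h1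
    · exact ⟨_, hdown y hy, by simpa using hm (-h) h1⟩
    · exact ⟨_, hup y hy, h1⟩
  · intro v z hz hvz y hy
    have hv := hJ.mem_stab (hCs hz).1 (hCs hvz).1
    -- The interval from `v +ᵥ z` to `v +ᵥ y` is the translate of one avoiding the fixed points of
    -- `h`; as `V` is commutative, `v` preserves that fixed point set.
    refine Set.mem_ordConnectedComponent_trans hvz fun w hw => ?_
    have hzy : Set.uIcc z y ⊆ J \ {z | h +ᵥ z = z} :=
      Set.mem_ordConnectedComponent_trans (Set.mem_ordConnectedComponent_comm.1 hz) hy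
    have hw' : -v +ᵥ w ∈ Set.uIcc z y := by
      have hmon := (hm (-v)).monotone
      rcases Set.mem_uIcc.1 hw with ⟨h1, h2⟩ | ⟨h1, h2⟩
      · exact Set.mem_uIcc.2 (Or.inl ⟨by simpa using hmon h1, by simpa using hmon h2⟩)
      · exact Set.mem_uIcc.2 (Or.inr ⟨by simpa using hmon h1, by simpa using hmon h2⟩)
    obtain ⟨h1, h2⟩ := hzy hw'
    refine ⟨(neg_mem hv w).1 h1, fun h3 : h +ᵥ w = w => h2 ?_⟩
    change h +ᵥ (-v +ᵥ w) = -v +ᵥ w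
    rw [vadd_comm, h3]

/-- Transitivity supplies a return to `J` taking a point of the component to the other side of the
fixed point `p`. If it preserved the component, convexity would put `p` in it. -/
theorem IsWandering.exists_notMem_stab_component {J : Set Ω} (hJ : IsWandering V J)
    (hT : TransOn (⊤ : AddSubgroup V) (Set.univ : Set Ω)) {h : V} (hh : h ∈ stab V J)
    {x p : Ω} (hx : x ∈ J) (hne : h +ᵥ x ≠ x) (hp : p ∈ J) (hfix : h +ᵥ p = p) :
    ∃ v ∈ stab V J, v ∉ stab V (Set.ordConnectedComponent (J \ {z | h +ᵥ z = z}) x) := by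
  have hC := hJ.component hm hh hx hne
  have hxC : x ∈ Set.ordConnectedComponent (J \ {z | h +ᵥ z = z}) x :=
    Set.self_mem_ordConnectedComponent.2 ⟨hx, hne⟩
  set C := Set.ordConnectedComponent (J \ {z | h +ᵥ z = z}) x
  have hCs : C ⊆ J \ {z | h +ᵥ z = z} := Set.ordConnectedComponent_subset
  have hpC : p ∉ C := fun hpC => (hCs hpC).2 hfix
  have hTJ := hJ.transOn_inf hT
  obtain ⟨a, ha, hap⟩ := hJ.noMin p hp
  obtain ⟨b, hb, hpb⟩ := hJ.noMax p hp
  obtain ⟨x', hx', hxx'⟩ := hC.noMax x hxC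
  rcases lt_or_gt_of_ne (fun e => hpC (e ▸ hxC) : p ≠ x) with hpx | hpx
  · obtain ⟨v, hv, y, h1, h2, h3, h4⟩ := hTJ hx (hCs hx').1 ha hp hxx' hap
    refine ⟨v, hv.2, fun hvC => hpC ?_⟩
    exact hC.conn.out ((hvC y).2 (hC.conn.out hxC hx' ⟨h1.le, h2.le⟩)) hxC ⟨h4.le, hpx.le⟩
  · obtain ⟨v, hv, y, h1, h2, h3, h4⟩ := hTJ hx (hCs hx').1 hp hb hxx' hpb
    refine ⟨v, hv.2, fun hvC => hpC ?_⟩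
    exact hC.conn.out hxC ((hvC y).2 (hC.conn.out hxC hx' ⟨h1.le, h2.le⟩)) ⟨hpx.le, h3.le⟩

omit [LinearOrder Ω] [AddAction V Ω] hm in
theorem finrank_lt_finrank_of_lt_of_pure [Module.Finite ℤ V] {A B : AddSubgroup V} (hAB : A ≤ B)
    (hA : ∀ (v : V) (c : ℤ), c ≠ 0 → c • v ∈ A → v ∈ A) {v : V} (hvB : v ∈ B) (hvA : v ∉ A) :
    finrank ℤ A < finrank ℤ B := by
  let A' := AddSubgroup.toIntSubmodule A
  let B' := AddSubgroup.toIntSubmodule B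
  have hAB' : A' ≤ B' := hAB
  change finrank ℤ A' < finrank ℤ B'
  have h1 := (A'.submoduleOf B').finrank_quotient_add_finrank
  rw [(Submodule.submoduleOfEquivOfLe hAB').finrank_eq] at h1
  suffices finrank ℤ (B' ⧸ A'.submoduleOf B') ≠ 0 by omega
  intro h0
  rw [finrank_eq_zero_iff_isTorsion] at h0
  obtain ⟨c, hc⟩ := @h0 (Submodule.Quotient.mk ⟨v, hvB⟩)
  apply hvA
  refine hA v c (nonZeroDivisors.coe_ne_zero c) ?_
  rw [Submonoid.smul_def, ← Submodule.Quotient.mk_smul, Submodule.Quotient.mk_eq_zero] at hc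
  exact hc

/-- There is a wandering interval on which its stabilizer acts freely (modulo its kernel). -/
theorem exists_isWandering_free [Module.Finite ℤ V] [NoMinOrder Ω] [NoMaxOrder Ω] [Nonempty Ω]
    (hT : TransOn (⊤ : AddSubgroup V) (Set.univ : Set Ω)) :
    ∃ J : Set Ω, IsWandering V J ∧
      ∀ h ∈ stab V J, ∀ p ∈ J, h +ᵥ p = p → ∀ x ∈ J, h +ᵥ x = x := by
  suffices H : ∀ (n : ℕ) (J : Set Ω), finrank ℤ (stab V J) = n → IsWandering V J →
      ∃ J : Set Ω, IsWandering V J ∧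
        ∀ h ∈ stab V J, ∀ p ∈ J, h +ᵥ p = p → ∀ x ∈ J, h +ᵥ x = x from
    H _ _ rfl isWandering_univ
  intro n
  induction n using Nat.strong_induction_on with
  | _ n ih =>
  intro J hn hJ
  by_contra! hcon
  obtain ⟨h, hh, p, hp, hfix, x, hx, hne⟩ := hcon J hJ
  have hC := hJ.component hm hh hx hne
  obtain ⟨v, hvJ, hvC⟩ := hJ.exists_notMem_stab_component hm hT hh hx hne hp hfix
  have hle : stab V (Set.ordConnectedComponent (J \ {z | h +ᵥ z = z}) x) ≤ stab V J := by
    intro u hu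
    have hxC : x ∈ Set.ordConnectedComponent (J \ {z | h +ᵥ z = z}) x :=
      Set.self_mem_ordConnectedComponent.2 ⟨hx, hne⟩
    exact hJ.mem_stab hx (Set.ordConnectedComponent_subset ((hu x).2 hxC)).1
  -- The smaller stabilizer is pure, so a proper inclusion lowers the rank and the descent
  -- terminates.
  have hlt := finrank_lt_finrank_of_lt_of_pure hle (fun w c hc hw => hC.pure hm hc hw) hvJ hvC
  obtain ⟨J', h1, h2⟩ := ih _ (hn ▸ hlt) _ rfl hC
  obtain ⟨h', hh', p', hp', hf', x', hx', hne'⟩ := hcon J' h1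
  exact hne' (h2 h' hh' p' hp' hf' x' hx')

section Complete

variable (hsup : ∀ s : Set Ω, s.Nonempty → BddAbove s → ∃ m, IsLUB s m)
include hsup

/-- The supremum of a bounded forward orbit is fixed. -/
theorem exists_fixed_of_nsmul_le {s : V} {x y : Ω} (hx : x ≤ s +ᵥ x)
    (hy : ∀ n : ℕ, n • s +ᵥ x ≤ y) : ∃ m, x ≤ m ∧ m ≤ y ∧ s +ᵥ m = m := by
  obtain ⟨m, hlub⟩ := hsup (Set.range fun n : ℕ => n • s +ᵥ x) ⟨x, 0, by simp⟩
    ⟨y, by rintro _ ⟨n, rfl⟩; exact hy n⟩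
  refine ⟨m, hlub.1 ⟨0, by simp⟩, hlub.2 (by rintro _ ⟨n, rfl⟩; exact hy n), le_antisymm ?_ ?_⟩
  · have : m ≤ -s +ᵥ m := by
      refine hlub.2 ?_
      rintro _ ⟨n, rfl⟩
      have h1 : (n + 1) • s +ᵥ x ≤ m := hlub.1 ⟨n + 1, rfl⟩
      have h2 := (hm (-s)).monotone h1
      simp only [succ_nsmul', add_vadd, neg_vadd_vadd] at h2
      exact h2
    simpa using (hm s).monotone this
  · refine hlub.2 ?_
    rintro _ ⟨n, rfl⟩
    have h1 : n • s +ᵥ x ≤ m := hlub.1 ⟨n, rfl⟩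
    have h2 := (hm s).monotone h1
    simp only [vadd_comm s (n • s) x] at h2
    exact ((hm (n • s)).monotone hx).trans h2

variable {J : Set Ω} (hJ : IsWandering V J) (hfree : ∀ h ∈ stab V J, ∀ p ∈ J, h +ᵥ p = p → h = 0)
include hJ hfree

theorem exists_lt_nsmul_vadd {s : V} (hs : s ∈ stab V J) {x y : Ω} (hxJ : x ∈ J) (hy : y ∈ J)
    (hx : x < s +ᵥ x) : ∃ n : ℕ, y < n • s +ᵥ x := by
  by_contra! h
  obtain ⟨m, h1, h2, h3⟩ := exists_fixed_of_nsmul_le hm hsup hx.le h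
  have := hfree s hs m (hJ.conn.out hxJ hy ⟨h1, h2⟩) h3
  simp [this] at hx

/-- If `x < y` moved towards each other, the forward orbit of `x` would be trapped below `y` and
accumulate at a fixed point, against freeness. The other cases reduce to this one by passing to
`-s`. -/
theorem lt_vadd_of_lt_vadd {s : V} (hs : s ∈ stab V J) {x y : Ω} (hxJ : x ∈ J) (hyJ : y ∈ J)
    (hx : x < s +ᵥ x) : y < s +ᵥ y := by
  have key : ∀ s ∈ stab V J, ∀ x ∈ J, ∀ y ∈ J, x < y → x < s +ᵥ x → ¬ s +ᵥ y < y := by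
    intro s hs x hx y hy hxy h1 h2
    obtain ⟨n, hn⟩ := exists_lt_nsmul_vadd hm hsup hJ hfree hs hx hy h1
    have h3 := le_nsmul_vadd hm (v := -s) (x := y) (by simpa using (hm (-s) h2).le) n
    have h4 := (hm (n • s)).monotone h3
    simp only [smul_neg, vadd_neg_vadd] at h4
    exact absurd (hn.trans (hm (n • s) hxy)) h4.not_gt
  rcases lt_trichotomy y (s +ᵥ y) with h | h | h
  · exact h
  · have := hfree s hs y hyJ h.symm
    simp [this] at hx
  · rcases lt_trichotomy x y with hxy | rfl | hxy
    · exact absurd h (key s hs x hxJ y hyJ hxy hx)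
    · exact absurd h hx.not_gt
    · exact absurd (by simpa using hm (-s) hx)
        (key (-s) (neg_mem hs) y hyJ x hxJ hxy (by simpa using hm (-s) h))

/-- If the stabilizer of `J` acts freely and transitively on the intervals of `J`, so does each
subgroup containing two independent elements. -/
theorem transOn_of_indep [DenselyOrdered Ω] (hT : TransOn (stab V J) J) {L : AddSubgroup V}
    {u b : V} (huL : u ∈ L) (hbL : b ∈ L) (hu : u ∈ stab V J) (hb : b ∈ stab V J)
    (hind : ∀ i j : ℤ, i • u + j • b = 0 → i = 0 ∧ j = 0) : TransOn (L ⊓ stab V J) J := by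
  obtain ⟨x₀, hx₀⟩ := hJ.ne
  let K := stab V J
  have hinj : Function.Injective fun v : K => (v : V) +ᵥ x₀ := by
    intro v w hvw
    have h1 : (v - w : V) +ᵥ x₀ = x₀ := by
      have := congrArg (fun z => -(w : V) +ᵥ z) hvw
      simp only [← add_vadd] at this
      rw [sub_eq_neg_add, this, neg_add_cancel, zero_vadd]
    exact Subtype.ext (sub_eq_zero.1 (hfree _ (sub_mem v.2 w.2) x₀ hx₀ h1))
  -- The stabilizer is ordered by its free orbit of `x₀`, as in Hölder's theorem.
  let _ : LinearOrder K := LinearOrder.lift' _ hinj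
  have hlt : ∀ v w : K, v < w ↔ (v : V) +ᵥ x₀ < (w : V) +ᵥ x₀ := fun _ _ => Iff.rfl
  have hle : ∀ v w : K, v ≤ w ↔ (v : V) +ᵥ x₀ ≤ (w : V) +ᵥ x₀ := fun _ _ => Iff.rfl
  have : IsOrderedAddMonoid K := by
    have key : ∀ a b : K, a ≤ b → ∀ c : K, c + a ≤ c + b := by
      intro a b hab c
      rw [hle] at hab ⊢
      simp only [AddSubgroup.coe_add, add_vadd]
      exact (hm c).monotone hab
    exact ⟨fun a b hab c => by simpa only [add_comm _ c] using key a b hab c, key⟩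
  have hpos : ∀ v : K, 0 < v → ∀ z ∈ J, z < (v : V) +ᵥ z := by
    intro v hv z hz
    rw [hlt] at hv
    exact lt_vadd_of_lt_vadd hm hsup hJ hfree v.2 hx₀ hz (by simpa using hv)
  have : Archimedean K := by
    refine ⟨fun w v hv => ?_⟩
    obtain ⟨n, hn⟩ := exists_lt_nsmul_vadd hm hsup hJ hfree v.2 hx₀ ((w.2 x₀).2 hx₀)
      (hpos v hv x₀ hx₀)
    exact ⟨n, (hle _ _).2 (by simpa using hn.le)⟩
  let M : AddSubgroup K := L.comap K.subtype
  -- A subgroup of an Archimedean group without small positive elements is cyclic, which two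
  -- independent elements forbid.
  have hsmall : ∀ s : K, 0 < s → ∃ l ∈ M, 0 < l ∧ l < s := by
    intro s hs
    by_contra! hcon
    have hdisj : Disjoint (M : Set K) (Set.Ioo 0 s) :=
      Set.disjoint_left.2 fun l hl hl' => absurd hl'.2 (hcon l hl hl'.1).not_gt
    obtain ⟨z, hz⟩ := AddSubgroup.cyclic_of_isolated_zero hs hdisj
    have huM : (⟨u, hu⟩ : K) ∈ M := huL
    have hbM : (⟨b, hb⟩ : K) ∈ M := hbL
    rw [hz, AddSubgroup.mem_closure_singleton] at huM hbM
    obtain ⟨i, hi⟩ := huM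
    obtain ⟨j, hj⟩ := hbM
    have hi' : i • (z : V) = u := congrArg Subtype.val hi
    have hj' : j • (z : V) = b := congrArg Subtype.val hj
    have h1 := hind j (-i) (by rw [← hi', ← hj', smul_smul, smul_smul, ← add_smul]; ring_nf; simp)
    have h2 : u = 0 := by rw [← hi', neg_eq_zero.1 h1.2, zero_smul]
    exact one_ne_zero (hind 1 0 (by simp [h2])).1
  intro p q c d hp hq hc hd hpq hcd
  obtain ⟨e, hce, hed⟩ := exists_between hcd
  obtain ⟨e', hee, hed'⟩ := exists_between hed
  have heJ := hJ.conn.out hc hd ⟨hce.le, hed.le⟩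
  have heJ' := hJ.conn.out heJ hd ⟨hee.le, hed'.le⟩
  -- Here `h` lands `x` in `(c, e)`, and `s` moves `z` from beyond `e` to a point still below `d`.
  -- So any `t` in `L` with `h < t < h + s` sends `x` into `(c, d)`; a multiple of a small `l`
  -- provides one.
  obtain ⟨h, hh, x, h1, h2, h3, h4⟩ := hT hp hq hc heJ hpq hce
  obtain ⟨s, hs, z, h5, h6, h7, h8⟩ := hT heJ heJ' heJ' hd hee hed'
  have hz := hJ.conn.out heJ heJ' ⟨h5.le, h6.le⟩
  have hx := hJ.conn.out hp hq ⟨h1.le, h2.le⟩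
  have hs0 : (0 : K) < ⟨s, hs⟩ := by
    rw [hlt]
    simpa using lt_vadd_of_lt_vadd hm hsup hJ hfree hs hz hx₀ (h6.trans h7)
  obtain ⟨l, hlM, hl0, hls⟩ := hsmall _ hs0
  obtain ⟨k, ⟨hk1, hk2⟩, -⟩ := existsUnique_zsmul_near_of_pos hl0 (⟨h, hh⟩ : K)
  have hML : (((k + 1) • l : K) : V) ∈ L := zsmul_mem hlM (k + 1)
  set t : K := (k + 1) • l with ht
  have hth : t - ⟨h, hh⟩ < ⟨s, hs⟩ := by
    refine lt_of_le_of_lt ?_ hls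
    rw [ht, add_smul, one_smul, sub_le_iff_le_add, add_comm]
    exact add_le_add_right hk1 l
  have e1 : (t : V) +ᵥ x = ((t - ⟨h, hh⟩ : K) : V) +ᵥ (h +ᵥ x) := by
    rw [← add_vadd]; simp
  refine ⟨t, ⟨hML, t.2⟩, x, h1, h2, ?_, ?_⟩
  · rw [e1]
    exact h3.trans (hpos _ (sub_pos.2 hk2) _ ((hh x).2 hx))
  · rw [e1]
    have h9 : ((t - ⟨h, hh⟩ : K) : V) +ᵥ (h +ᵥ x) < ((t - ⟨h, hh⟩ : K) : V) +ᵥ z :=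
      hm _ (h4.trans h5)
    have h10 := hpos _ (sub_pos.2 hth) _ (((t - ⟨h, hh⟩ : K).2 z).2 hz)
    rw [← add_vadd] at h10
    have e2 : (((⟨s, hs⟩ - (t - ⟨h, hh⟩) : K) : V) + ((t - ⟨h, hh⟩ : K) : V)) = s := by
      rw [← AddSubgroup.coe_add, sub_add_cancel]
    rw [e2] at h10
    exact (h9.trans h10).trans h8

end Complete

end LineActions

/-! ### Extracting a free wandering interval and two independent elements -/

section Line

variable {Ω V : Type*} [LinearOrder Ω] [DenselyOrdered Ω] [NoMinOrder Ω] [NoMaxOrder Ω]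
  [Nonempty Ω] [AddCommGroup V] [AddAction V Ω] [Module.Finite ℤ V] [Module.Free ℤ V]

/-- Two elements of an abelian group that are independent over `ℤ`. -/
def Indep {V : Type*} [AddCommGroup V] (u b : V) : Prop :=
  ∀ i j : ℤ, i • u + j • b = 0 → i = 0 ∧ j = 0

theorem exists_isWandering_indep (hm : ∀ v : V, StrictMono fun x : Ω => v +ᵥ x)
    (hsup : ∀ s : Set Ω, s.Nonempty → BddAbove s → ∃ m, IsLUB s m)
    (hfaith : ∀ (v : V) (c d : Ω), c < d → (∀ x, c < x → x < d → v +ᵥ x = x) → v = 0)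
    {F : AddSubgroup V} (hF : TransOn F (Set.univ : Set Ω)) :
    ∃ J : Set Ω, IsWandering V J ∧
      (∃ a b, a ∈ F ⊓ stab V J ∧ b ∈ F ⊓ stab V J ∧ Indep a b) ∧
      ∀ (L : AddSubgroup V) (u b : V), u ∈ L → b ∈ L → u ∈ stab V J → b ∈ stab V J → Indep u b →
        TransOn (L ⊓ stab V J) J := by
  obtain ⟨J, hJ, hJf⟩ := exists_isWandering_free hm (hF.mono le_top)
  have hfree : ∀ h ∈ stab V J, ∀ p ∈ J, h +ᵥ p = p → h = 0 := by
    intro h hh p hp hfix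
    obtain ⟨x, hx⟩ := hJ.ne
    obtain ⟨y, hy, hxy⟩ := hJ.noMax x hx
    exact hfaith h x y hxy fun z h1 h2 =>
      hJf h hh p hp hfix z (hJ.conn.out hx hy ⟨h1.le, h2.le⟩)
  have hTF := hJ.transOn_inf hF
  refine ⟨J, hJ, ?_, fun L u b huL hbL hu hb hi =>
    transOn_of_indep hm hsup hJ hfree (hTF.mono inf_le_right) huL hbL hu hb hi⟩
  let P := AddSubgroup.toIntSubmodule (F ⊓ stab V J)
  -- In rank at most 1 the group `P` would be cyclic, hence not transitive on the intervals of `J`.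
  have h1 : 1 < finrank ℤ P := by
    by_contra! hcon
    obtain ⟨v, hv⟩ := (finrank_le_one_iff (K := ℤ) (V := P)).1 hcon
    refine not_transOn_of_cyclic hm hJ inf_le_right (v := v) v.2 (fun w hw => ?_) hTF
    obtain ⟨c, hc⟩ := hv ⟨w, hw⟩
    exact ⟨c, congrArg Subtype.val hc⟩
  have : Nontrivial P := nontrivial_of_finrank_pos (zero_lt_one.trans h1)
  obtain ⟨x, hx⟩ := exists_ne (0 : P)
  obtain ⟨y, hy⟩ := exists_linearIndependent_pair_of_one_lt_finrank h1 hx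
  rw [LinearIndependent.pair_iff] at hy
  exact ⟨x, y, x.2, y.2, fun i j h => hy i j (Subtype.ext h)⟩

end Line

/-! ### Ranks, indices and the construction of a small subgroup -/

section Algebra

/-- If both `w` and `w + k • a` were dependent on `b`, eliminating `w` would give a relation between
`a` and `b`. -/
theorem Indep.exists_add_smul {V : Type*} [AddCommGroup V] {a b : V} (hab : Indep a b) (w : V)
    {k : ℤ} (hk : k ≠ 0) : ∃ h, (h = 0 ∨ h = a) ∧ Indep (w + k • h) b := by
  by_contra! hcon
  have h1 := hcon 0 (Or.inl rfl)
  have h2 := hcon a (Or.inr rfl)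
  simp only [Indep, not_forall, smul_zero, add_zero] at h1 h2
  obtain ⟨i, j, h1, hij⟩ := h1
  obtain ⟨i', j', h2, hij'⟩ := h2
  have h3 : (i * i' * k) • a + (i * j' - i' * j) • b = 0 := by
    have e : (i * i' * k) • a + (i * j' - i' * j) • b =
        i • (i' • (w + k • a) + j' • b) - i' • (i • w + j • b) := by
      module
    rw [e, h1, h2]; simp
  have h4 := (hab _ _ h3).1
  rcases mul_eq_zero.1 ((mul_eq_zero.1 h4).resolve_right hk) with rfl | rfl
  · exact hij ⟨rfl, (hab 0 j (by simpa using h1)).2⟩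
  · exact hij' ⟨rfl, (hab 0 j' (by simpa using h2)).2⟩

theorem finrank_lt_of_index_eq_zero {V : Type*} [AddCommGroup V] [Module.Finite ℤ V]
    {F : AddSubgroup V} (hF : F.index = 0) : finrank ℤ F < finrank ℤ V := by
  have h1 := (AddSubgroup.toIntSubmodule F).finrank_quotient_add_finrank
  change _ + finrank ℤ F = _ at h1
  suffices finrank ℤ (V ⧸ AddSubgroup.toIntSubmodule F) ≠ 0 by omega
  intro h0
  rw [finrank_eq_zero_iff_isTorsion] at h0
  have : Finite (V ⧸ AddSubgroup.toIntSubmodule F) := Module.finite_of_fg_torsion _ h0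
  have h2 : Finite (V ⧸ F) := this
  exact AddSubgroup.index_ne_zero_of_finite hF

theorem index_eq_zero_of_finrank_lt {V : Type*} [AddCommGroup V] [Module.Finite ℤ V]
    {F : AddSubgroup V} (hF : finrank ℤ F < finrank ℤ V) : F.index = 0 := by
  by_contra hne
  have h1 := (AddSubgroup.toIntSubmodule F).finrank_quotient_add_finrank
  change _ + finrank ℤ F = _ at h1
  suffices finrank ℤ (V ⧸ AddSubgroup.toIntSubmodule F) = 0 by omega
  rw [finrank_eq_zero_iff_isTorsion]
  intro x
  obtain ⟨v, rfl⟩ := Submodule.Quotient.mk_surjective _ x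
  refine ⟨⟨(F.index : ℤ), mem_nonZeroDivisors_of_ne_zero (by exact_mod_cast hne)⟩, ?_⟩
  rw [Submonoid.smul_def, ← Submodule.Quotient.mk_smul, Submodule.Quotient.mk_eq_zero]
  change (F.index : ℤ) • v ∈ F
  rw [natCast_zsmul]
  exact AddSubgroup.nsmul_index_mem F v

/-- Rank-nullity for the surjection from `F` to `V ⧸ S`, whose kernel contains `a` and `b`. -/
theorem two_add_finrank_quotient_le {V : Type*} [AddCommGroup V] [Module.Finite ℤ V]
    {F S : Submodule ℤ V} (hFS : F ⊔ S = ⊤) {a b : V} (ha : a ∈ F ⊓ S) (hb : b ∈ F ⊓ S)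
    (hab : Indep a b) : finrank ℤ (V ⧸ S) + 2 ≤ finrank ℤ F := by
  let f : F →ₗ[ℤ] V ⧸ S := S.mkQ.comp F.subtype
  have hf : LinearMap.range f = ⊤ := by
    rw [LinearMap.range_comp, Submodule.range_subtype, Submodule.map_mkQ_eq_top, sup_comm, hFS]
  have h1 := (LinearMap.ker f).finrank_quotient_add_finrank
  rw [f.quotKerEquivRange.finrank_eq, hf, finrank_top] at h1
  have h2 : LinearIndependent ℤ ![(⟨⟨a, ha.1⟩, by simpa [f] using ha.2⟩ : LinearMap.ker f),
      ⟨⟨b, hb.1⟩, by simpa [f] using hb.2⟩] := by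
    rw [LinearIndependent.pair_iff]
    intro i j h
    exact hab i j (congrArg (fun z : LinearMap.ker f => ((z : F) : V)) h)
  have h3 := h2.fintype_card_le_finrank
  simp only [Fintype.card_fin] at h3
  omega

/-- The algebra behind the passage from a stabilizer to the whole group. -/
theorem exists_index_eq_zero {Γ : Type*} [AddCommGroup Γ] [Module.Finite ℤ Γ]
    {H : AddSubgroup Γ} {F S : AddSubgroup H} (hF : F.index = 0)
    (hS : ∀ (v : H) (c : ℤ), c ≠ 0 → c • v ∈ S → v ∈ S) (hFS : F ⊔ S = ⊤) {a b : H}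
    (ha : a ∈ F ⊓ S) (hb : b ∈ F ⊓ S) (hab : Indep a b) {g : Γ} {k : ℤ} (hk : k ≠ 0)
    (hg : k • g ∈ H) (hgen : ∀ v : Γ, ∃ m : ℤ, v - m • g ∈ H) :
    ∃ L : AddSubgroup Γ, L.index = 0 ∧ (∀ γ : Γ, ∃ l ∈ L, ∃ s ∈ S, γ = l + (s : H)) ∧
      ∃ u ∈ S, ∃ b ∈ S, ((u : H) : Γ) ∈ L ∧ ((b : H) : Γ) ∈ L ∧ Indep u b := by
  have hHfin : Module.Finite ℤ H :=
    inferInstanceAs (Module.Finite ℤ (AddSubgroup.toIntSubmodule H))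
  have hFlt := finrank_lt_of_index_eq_zero hF
  have hHle : finrank ℤ H ≤ finrank ℤ Γ := Submodule.finrank_le (AddSubgroup.toIntSubmodule H)
  let F' := AddSubgroup.toIntSubmodule F
  let S' := AddSubgroup.toIntSubmodule S
  have hsup : F' ⊔ S' = ⊤ := by
    rw [eq_top_iff]
    intro v _
    have hv : v ∈ F ⊔ S := hFS ▸ AddSubgroup.mem_top v
    obtain ⟨x, hx, y, hy, rfl⟩ := AddSubgroup.mem_sup.1 hv
    exact Submodule.add_mem_sup hx hy
  have hq : finrank ℤ (H ⧸ S') + 2 ≤ finrank ℤ F := two_add_finrank_quotient_le hsup ha hb hab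
  have htf : Module.IsTorsionFree ℤ (H ⧸ S') := by
    refine Module.IsTorsionFree.of_smul_eq_zero fun c x hcx => ?_
    obtain ⟨v, rfl⟩ := Submodule.Quotient.mk_surjective _ x
    rw [← Submodule.Quotient.mk_smul, Submodule.Quotient.mk_eq_zero] at hcx
    by_cases hc : c = 0
    · exact Or.inl hc
    · exact Or.inr ((Submodule.Quotient.mk_eq_zero _).2 (hS v c hc hcx))
  have hfree : Module.Free ℤ (H ⧸ S') := Module.free_of_finite_type_torsion_free'
  let β := finBasis ℤ (H ⧸ S')
  choose m hmβ using fun i => Submodule.Quotient.mk_surjective S' (β i)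
  have hdec : ∀ v : H, ∃ c : Fin (finrank ℤ (H ⧸ S')) → ℤ, v - ∑ i, c i • m i ∈ S := by
    intro v
    refine ⟨fun i => β.repr (Submodule.Quotient.mk v) i, ?_⟩
    have h1 : (Submodule.Quotient.mk (v - ∑ i, β.repr (Submodule.Quotient.mk v) i • m i) :
        H ⧸ S') = 0 := by
      rw [Submodule.Quotient.mk_sub, sub_eq_zero, ← Submodule.mkQ_apply S' (∑ i, _), map_sum]
      simp only [map_smul, Submodule.mkQ_apply, hmβ]
      exact (β.sum_repr _).symm
    exact (Submodule.Quotient.mk_eq_zero _).1 h1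
  obtain ⟨c, hc⟩ := hdec ⟨k • g, hg⟩
  -- The part of `k • g` in `S` once the lifts `m i` are removed. Replacing `g` by `g + h` changes
  -- it to `w + k • h`, which can be made independent of `b`.
  set w : H := ⟨k • g, hg⟩ - ∑ i, c i • m i with hw
  obtain ⟨h, hh, hind⟩ := hab.exists_add_smul w hk
  have hhS : h ∈ S := by
    rcases hh with rfl | rfl
    · exact zero_mem _
    · exact ha.2
  let gens : (Fin (finrank ℤ (H ⧸ S')) ⊕ Fin 2) → Γ := Sum.elim (fun i => (m i : Γ)) ![g + h, b]
  let L := Submodule.span ℤ (Set.range gens)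
  have hmL : ∀ i, (m i : Γ) ∈ L := fun i => Submodule.subset_span ⟨Sum.inl i, rfl⟩
  have hgL : g + h ∈ L := Submodule.subset_span ⟨Sum.inr 0, rfl⟩
  have hbL : (b : Γ) ∈ L := Submodule.subset_span ⟨Sum.inr 1, rfl⟩
  have hsumL : ∀ c : Fin (finrank ℤ (H ⧸ S')) → ℤ, ((∑ i, c i • m i : H) : Γ) ∈ L := by
    intro c
    rw [AddSubgroup.val_finsetSum]
    exact Submodule.sum_mem _ fun i _ => Submodule.smul_mem _ _ (hmL i)
  refine ⟨L.toAddSubgroup, ?_, ?_, w + k • h, ?_, b, hb.2, ?_, hbL, hind⟩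
  -- The number of generators is `rank (H / S) + 2`, at most the rank of `F`, which is less than
  -- that of `H`.
  · apply index_eq_zero_of_finrank_lt
    have h1 : finrank ℤ L ≤ _ := finrank_range_le_card gens
    change finrank ℤ L < _
    simp only [Fintype.card_sum, Fintype.card_fin] at h1
    omega
  · intro γ
    obtain ⟨n, hn⟩ := hgen γ
    obtain ⟨d, hd⟩ := hdec (⟨γ - n • g, hn⟩ - n • h)
    refine ⟨n • (g + h) + ((∑ i, d i • m i : H) : Γ),
      L.add_mem (L.smul_mem _ hgL) (hsumL d), _, hd, ?_⟩
    simp only [AddSubgroup.coe_sub, AddSubgroup.coe_zsmul]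
    module
  · exact add_mem hc (zsmul_mem hhS k)
  · have e : ((w + k • h : H) : Γ) = k • (g + h) - ((∑ i, c i • m i : H) : Γ) := by
      rw [hw]
      simp only [AddSubgroup.coe_sub, AddSubgroup.coe_zsmul, AddSubgroup.coe_add]
      module
    rw [e]
    exact L.sub_mem (L.smul_mem _ hgL) (hsumL c)

end Algebra

/-! ### From the line to the ambient space -/

section Chart

variable {Γ X Ω : Type*} [AddCommGroup Γ] {φ : Γ → X → X} {c : Ω → X} {H : AddSubgroup Γ}

/-- The action on `Ω` of a group `H` that preserves the image of an injection `c : Ω → X`. -/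
@[reducible] noncomputable def chartAction (hφ0 : ∀ x, φ 0 x = x)
    (hφ : ∀ u v x, φ (u + v) x = φ u (φ v x)) (hc : Function.Injective c)
    (hH : ∀ v ∈ H, ∀ w, ∃ w', c w' = φ v (c w)) : AddAction H Ω where
  vadd v w := (hH v v.2 w).choose
  zero_vadd w := hc <| ((hH 0 H.zero_mem w).choose_spec).trans (hφ0 _)
  add_vadd u v w := hc <| by
    refine (hH _ (H.add_mem u.2 v.2) w).choose_spec.trans ?_
    rw [hφ, ← (hH v v.2 w).choose_spec]
    exact ((hH u u.2 _).choose_spec).symm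

theorem chartAction_spec (hφ0 : ∀ x, φ 0 x = x)
    (hφ : ∀ u v x, φ (u + v) x = φ u (φ v x)) (hc : Function.Injective c)
    (hH : ∀ v ∈ H, ∀ w, ∃ w', c w' = φ v (c w)) (v : H) (w : Ω) :
    c ((chartAction hφ0 hφ hc hH).toVAdd.vadd v w) = φ v (c w) :=
  (hH v v.2 w).choose_spec

/-- If a subgroup of infinite index of `H` is transitive on the intervals of `Ω`, then a subgroup of
infinite index of `Γ` is topologically transitive. -/
theorem exists_infinite_index_transitive [LinearOrder Ω] [NoMinOrder Ω] [NoMaxOrder Ω]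
    [DenselyOrdered Ω] [Nonempty Ω] [TopologicalSpace Ω]
    [OrderTopology Ω] [TopologicalSpace X] [T2Space X] [Module.Finite ℤ Γ] [Module.Free ℤ Γ]
    (hφ0 : ∀ x, φ 0 x = x) (hφ : ∀ u v x, φ (u + v) x = φ u (φ v x))
    (hφc : ∀ v, Continuous (φ v)) (hφf : ∀ v, (∀ x, φ v x = x) → v = 0)
    (hT : ∀ U V : Set X, IsOpen U → U.Nonempty → IsOpen V → V.Nonempty →
      ∃ v, ∃ x ∈ U, φ v x ∈ V)
    (hc : Function.Injective c) (hcc : Continuous c) (hco : IsOpenMap c)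
    (hsup : ∀ s : Set Ω, s.Nonempty → BddAbove s → ∃ m, IsLUB s m)
    (hH : ∀ v ∈ H, ∀ w, ∃ w', c w' = φ v (c w))
    (hmono : ∀ v ∈ H, ∀ w₁ w₂ y₁ y₂, w₁ < w₂ → c y₁ = φ v (c w₁) → c y₂ = φ v (c w₂) → y₁ < y₂)
    {F : AddSubgroup H} (hF : F.index = 0)
    (hFT : ∀ a b c' d : Ω, a < b → c' < d → ∃ v ∈ F, ∃ x y, a < x ∧ x < b ∧ c' < y ∧ y < d ∧
      c y = φ v (c x))
    {g : Γ} {k : ℤ} (hk : k ≠ 0) (hg : k • g ∈ H) (hgen : ∀ v : Γ, ∃ m : ℤ, v - m • g ∈ H) :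
    ∃ L : AddSubgroup Γ, L.index = 0 ∧ ∀ U V : Set X, IsOpen U → U.Nonempty → IsOpen V →
      V.Nonempty → ∃ v ∈ L, ∃ x ∈ U, φ v x ∈ V := by
  let _ : AddAction H Ω := chartAction hφ0 hφ hc hH
  have hspec : ∀ (v : H) (w : Ω), c (v +ᵥ w) = φ v (c w) := chartAction_spec hφ0 hφ hc hH
  have hm : ∀ v : H, StrictMono fun x : Ω => v +ᵥ x := fun v x y hxy =>
    hmono v v.2 x y _ _ hxy (hspec v x) (hspec v y)
  have hφn : ∀ v x, φ (-v) (φ v x) = x := fun v x => by rw [← hφ, neg_add_cancel, hφ0]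
  have hφn' : ∀ v x, φ v (φ (-v) x) = x := fun v x => by rw [← hφ, add_neg_cancel, hφ0]
  have hHfin : Module.Finite ℤ H :=
    inferInstanceAs (Module.Finite ℤ (AddSubgroup.toIntSubmodule H))
  have hHfree : Module.Free ℤ H :=
    inferInstanceAs (Module.Free ℤ (AddSubgroup.toIntSubmodule H))
  -- The open set of points moved by `v` is invariant under the commutative group; if nonempty,
  -- transitivity would bring points of the given interval into it.
  have hfaith : ∀ (v : H) (c d : Ω), c < d → (∀ x, c < x → x < d → v +ᵥ x = x) → v = 0 := by
    intro v c' d hcd hfix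
    refine Subtype.ext (hφf v fun z => ?_)
    by_contra hz
    obtain ⟨e, he⟩ := exists_between hcd
    obtain ⟨u, x, ⟨w, hw, rfl⟩, hx⟩ := hT (c '' Set.Ioo c' d) {z | φ v z ≠ z} (hco _ isOpen_Ioo)
      ⟨_, e, he, rfl⟩ (isOpen_ne_fun (hφc v) continuous_id) ⟨z, hz⟩
    refine hx ?_
    rw [← hφ, add_comm, hφ, ← hspec, hfix w hw.1 hw.2]
  have hFT' : TransOn F (Set.univ : Set Ω) := by
    intro a b c' d _ _ _ _ hab hcd
    obtain ⟨v, hv, x, y, h1, h2, h3, h4, h5⟩ := hFT a b c' d hab hcd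
    have h6 : v +ᵥ x = y := hc (by rw [hspec, h5])
    exact ⟨v, hv, x, h1, h2, by rwa [h6], by rwa [h6]⟩
  obtain ⟨J, hJ, ⟨a, b, ha, hb, hab⟩, hJT⟩ := exists_isWandering_indep hm hsup hfaith hFT'
  obtain ⟨L, hL0, hLS, u, huS, b', hbS, huL, hbL, hub⟩ := exists_index_eq_zero hF
    (fun v c hc hv => hJ.pure hm hc hv) (hJ.sup_eq_top hm hFT') ha hb hab hk hg hgen
  have hLT := hJT (L.comap H.subtype) u b' huL hbL huS hbS hub
  refine ⟨L, hL0, ?_⟩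
  obtain ⟨j₁, hj₁⟩ := hJ.ne
  obtain ⟨j₂, hj₂, hj⟩ := hJ.noMax j₁ hj₁
  -- Some `γ` brings a point of `U` into `J`. Writing `γ = l + s` with `s` stabilizing `J`, already
  -- `l` does so, and by openness its image of `U` covers an interval of `J`.
  have key : ∀ U : Set X, IsOpen U → U.Nonempty → ∃ l ∈ L, ∃ p ∈ J, ∃ q ∈ J, p < q ∧
      ∀ w, p < w → w < q → ∃ x ∈ U, φ l x = c w := by
    intro U hU hUne
    obtain ⟨e, he⟩ := exists_between hj
    obtain ⟨γ, x, hxU, w₀, hw₀, hxw⟩ := hT U (c '' Set.Ioo j₁ j₂) hU hUne (hco _ isOpen_Ioo)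
      ⟨_, e, he, rfl⟩
    obtain ⟨l, hl, s, hs, rfl⟩ := hLS γ
    have hw₀J : w₀ ∈ J := hJ.conn.out hj₁ hj₂ ⟨hw₀.1.le, hw₀.2.le⟩
    set z := -s +ᵥ w₀ with hz
    have hzJ : z ∈ J := ((neg_mem hs) w₀).2 hw₀J
    have hcz : c z = φ l x := by
      rw [hz, hspec, hxw, ← hφ]
      congr 1
      simp
    have hO : IsOpen (c ⁻¹' (φ (-l) ⁻¹' U)) := (hU.preimage (hφc _)).preimage hcc
    have hzO : z ∈ c ⁻¹' (φ (-l) ⁻¹' U) := by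
      change φ (-l) (c z) ∈ U
      rwa [hcz, hφn]
    obtain ⟨p, q, ⟨hp, hq⟩, hpq⟩ := mem_nhds_iff_exists_Ioo_subset.1 (hO.mem_nhds hzO)
    obtain ⟨p', hp'J, hp'⟩ := hJ.noMin z hzJ
    obtain ⟨q', hq'J, hq'⟩ := hJ.noMax z hzJ
    refine ⟨l, hl, max p p', hJ.conn.out hp'J hzJ ⟨le_max_right _ _, (max_lt hp hp').le⟩, min q q',
      hJ.conn.out hzJ hq'J ⟨(lt_min hq hq').le, min_le_right _ _⟩,
      (max_lt hp hp').trans (lt_min hq hq'), fun w h1 h2 => ?_⟩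
    exact ⟨φ (-l) (c w), hpq ⟨(le_max_left _ _).trans_lt h1, h2.trans_le (min_le_left _ _)⟩,
      hφn' _ _⟩
  intro U V hU hUne hV hVne
  obtain ⟨l₁, hl₁, p₁, hp₁, q₁, hq₁, hpq₁, h₁⟩ := key U hU hUne
  obtain ⟨l₂, hl₂, p₂, hp₂, q₂, hq₂, hpq₂, h₂⟩ := key V hV hVne
  obtain ⟨t, ⟨htL, -⟩, w, hw1, hw2, hw3, hw4⟩ := hLT hp₁ hq₁ hp₂ hq₂ hpq₁ hpq₂
  obtain ⟨x, hx, hxw⟩ := h₁ w hw1 hw2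
  obtain ⟨y, hy, hyw⟩ := h₂ _ hw3 hw4
  refine ⟨-l₂ + (t + l₁), L.add_mem (L.neg_mem hl₂) (L.add_mem htL hl₁), x, hx, ?_⟩
  rw [hφ, hφ, hxw, ← hspec, ← hyw, hφn]
  exact hy

end Chart

/-! ### Arcs of the circle and their real charts -/

section Circle

theorem ne_of_sbtw {α : Type*} [CircularOrder α] {p q r : α} (h : sbtw p q r) :
    p ≠ q ∧ q ≠ r ∧ r ≠ p := by
  refine ⟨?_, ?_, ?_⟩
  · rintro rfl; exact sbtw_irrefl_left h
  · rintro rfl; exact sbtw_irrefl_right h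
  · rintro rfl; exact sbtw_irrefl_left_right h

theorem sbtw_or_sbtw {α : Type*} [CircularOrder α] {p q r : α} (h1 : p ≠ q) (h2 : q ≠ r)
    (h3 : r ≠ p) : sbtw p q r ∨ sbtw r q p := by
  by_contra! h
  rw [← btw_iff_not_sbtw, ← btw_iff_not_sbtw] at h
  rcases h.1.antisymm h.2 with e | e | e
  · exact h2 e.symm
  · exact h1 e.symm
  · exact h3 e.symm

theorem mem_openArc {p q z : UnitAddCircle} :
    z ∈ openArc p q ↔ z ≠ p ∧ z ≠ q ∧ (p = q ∨ sbtw p z q) := by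
  simp only [openArc, Set.mem_ofPred_eq]
  refine and_congr_right fun h1 => and_congr_right fun h2 => ?_
  constructor
  · intro h
    by_cases hpq : p = q
    · exact Or.inl hpq
    · refine Or.inr (sbtw_iff_not_btw.2 fun h' => ?_)
      rcases h.antisymm h' with e | e | e
      · exact h1 e.symm
      · exact h2 e
      · exact hpq e.symm
  · rintro (rfl | h)
    · exact btw_rfl_left_right
    · exact h.btw

theorem mem_openArc_of_ne {p q z : UnitAddCircle} (hpq : p ≠ q) :
    z ∈ openArc p q ↔ sbtw p z q := by
  rw [mem_openArc]
  constructor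
  · rintro ⟨-, -, h⟩
    exact h.resolve_left hpq
  · intro h
    have := ne_of_sbtw h
    exact ⟨this.1.symm, this.2.1, Or.inr h⟩

theorem apply_mem_openArc {h : UnitAddCircle ≃ₜ UnitAddCircle} (hh : h ∈ homeoPlus)
    {p q z : UnitAddCircle} : h z ∈ openArc (h p) (h q) ↔ z ∈ openArc p q := by
  rw [mem_openArc, mem_openArc, hh p z q, h.injective.ne_iff, h.injective.ne_iff,
    h.injective.eq_iff]

theorem sbtw_of_sbtw_of_sbtw {α : Type*} [CircularOrder α] {x a b c : α} (h1 : sbtw x a b)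
    (h2 : sbtw x b c) : sbtw a b c :=
  (h2.cyclic_left.trans_right h1.cyclic_right).cyclic_right

/-- Two arcs with a common point, neither of which contains an endpoint of the other, start at the
same point. -/
theorem eq_of_mem_openArc {p q r s z : UnitAddCircle} (hpq : p ≠ q) (hrs : r ≠ s)
    (h1 : z ∈ openArc p q) (h2 : z ∈ openArc r s) (hr : r ∉ openArc p q) (hp : p ∉ openArc r s) :
    r = p := by
  rw [mem_openArc_of_ne hpq] at h1 hr
  rw [mem_openArc_of_ne hrs] at h2 hp
  by_contra hrp
  have hpz : sbtw r p z := by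
    by_cases hrq : r = q
    · rw [hrq]; exact h1.cyclic_right
    · rcases sbtw_or_sbtw (fun e => hrp e.symm) hrq hpq.symm with h | h
      · exact absurd h hr
      · exact sbtw_of_sbtw_of_sbtw h h1.cyclic_right
  exact hp (hpz.trans_right h2)

theorem sbtw_coe {a s t : ℝ} (hs : s ∈ Set.Ioo a (a + 1)) (ht : t ∈ Set.Ioo a (a + 1)) :
    sbtw (a : UnitAddCircle) s t ↔ s < t := by
  rw [sbtw_iff_not_btw, btw_cyclic]
  have h := QuotientAddGroup.btw_coe_iff (p := (1 : ℝ)) (x₁ := a) (x₂ := t) (x₃ := s)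
  rw [(toIcoMod_eq_self _).2 (Set.Ioo_subset_Ico_self ht),
    (toIocMod_eq_self _).2 (Set.Ioo_subset_Ioc_self hs)] at h
  exact (not_congr h).trans not_le

theorem coe_injOn (a : ℝ) : Set.InjOn (fun t : ℝ => (t : UnitAddCircle)) (Set.Ico a (a + 1)) :=
  fun _ hs _ ht h => (AddCircle.coe_eq_coe_iff_of_mem_Ico hs ht).1 h

theorem exists_coe_of_ne {a : ℝ} {z : UnitAddCircle} (hz : z ≠ a) :
    ∃ s ∈ Set.Ioo a (a + 1), (s : UnitAddCircle) = z := by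
  have h := (AddCircle.equivIco 1 a z).2
  refine ⟨AddCircle.equivIco 1 a z, ⟨lt_of_le_of_ne h.1 fun e => hz ?_, h.2⟩,
    AddCircle.coe_equivIco⟩
  have h2 : ((AddCircle.equivIco 1 a z : ℝ) : UnitAddCircle) = z := AddCircle.coe_equivIco
  rw [← h2, ← e]

theorem openArc_eq_image {a b : ℝ} (hab : a < b) (hb : b ≤ a + 1) :
    openArc (a : UnitAddCircle) b = (fun t : ℝ => (t : UnitAddCircle)) '' Set.Ioo a b := by
  have ha : a ∈ Set.Ico a (a + 1) := ⟨le_rfl, by linarith⟩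
  ext z
  constructor
  · intro hz
    obtain ⟨s, hs, rfl⟩ := exists_coe_of_ne (mem_openArc.1 hz).1
    refine ⟨s, ⟨hs.1, ?_⟩, rfl⟩
    rcases hb.lt_or_eq with hb' | rfl
    · have hbI : b ∈ Set.Ioo a (a + 1) := ⟨hab, hb'⟩
      have hne : (a : UnitAddCircle) ≠ b := fun e =>
        hab.ne (coe_injOn a ha (Set.Ioo_subset_Ico_self hbI) e)
      rw [mem_openArc_of_ne hne] at hz
      exact (sbtw_coe hs hbI).1 hz
    · exact hs.2
  · rintro ⟨s, hs, rfl⟩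
    have hsI : s ∈ Set.Ioo a (a + 1) := ⟨hs.1, hs.2.trans_le hb⟩
    rcases hb.lt_or_eq with hb' | rfl
    · have hbI : b ∈ Set.Ioo a (a + 1) := ⟨hab, hb'⟩
      have hne : (a : UnitAddCircle) ≠ b := fun e =>
        hab.ne (coe_injOn a ha (Set.Ioo_subset_Ico_self hbI) e)
      rw [mem_openArc_of_ne hne]
      exact (sbtw_coe hsI hbI).2 hs.2
    · have e : ((a + 1 : ℝ) : UnitAddCircle) = a := AddCircle.coe_add_period 1 a
      have hne : (s : UnitAddCircle) ≠ a := fun e =>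
        hs.1.ne' (coe_injOn a (Set.Ioo_subset_Ico_self hsI) ha e)
      rw [mem_openArc, e]
      exact ⟨hne, hne, Or.inl rfl⟩

theorem exists_chart_endpoints (p q : UnitAddCircle) :
    ∃ a b : ℝ, a < b ∧ b ≤ a + 1 ∧ (a : UnitAddCircle) = p ∧ (b : UnitAddCircle) = q := by
  obtain ⟨a, rfl⟩ := QuotientAddGroup.mk_surjective p
  have h := (AddCircle.equivIoc 1 a q).2
  exact ⟨a, AddCircle.equivIoc 1 a q, h.1, h.2, rfl, AddCircle.coe_equivIoc⟩

theorem isOpen_openArc (p q : UnitAddCircle) : IsOpen (openArc p q) := by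
  obtain ⟨a, b, hab, hb, rfl, rfl⟩ := exists_chart_endpoints p q
  rw [openArc_eq_image hab hb]
  exact QuotientAddGroup.isOpenMap_coe _ isOpen_Ioo

end Circle

/-! ### The group acts on the finite orbit by rotation -/

section FiniteOrbit

variable {G : Subgroup (UnitAddCircle ≃ₜ UnitAddCircle)} {k : ℕ} [NeZero k]
  {x : Fin k → UnitAddCircle}

omit [NeZero k] in
theorem IsAnticlockwise.not_sbtw_succ (hx : IsAnticlockwise x) {i j : Fin k}
    (hij : (j : ℕ) = i + 1) (l : Fin k) : ¬ sbtw (x i) (x l) (x j) := by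
  intro h
  obtain ⟨h1, h2, h3⟩ := ne_of_sbtw h
  have hil : l ≠ i := fun e => h1 (by rw [e])
  have hjl : l ≠ j := fun e => h2 (by rw [e])
  rw [Ne, Fin.ext_iff] at hil hjl
  rcases lt_or_gt_of_ne hil with h4 | h4
  · exact (hx.2 l i j h4 (by rw [Fin.lt_def]; omega)).not_sbtw h.cyclic_right
  · exact (hx.2 i j l (by rw [Fin.lt_def]; omega) (by rw [Fin.lt_def]; omega)).not_sbtw
      h.cyclic_left

theorem val_one_of_ne {k : ℕ} [NeZero k] (h : (0 : Fin k) ≠ 1) : ((1 : Fin k) : ℕ) = 1 := by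
  have hk : k ≠ 1 := by rintro rfl; exact h (Subsingleton.elim _ _)
  rw [Fin.val_one', Nat.mod_eq_of_lt]
  have := NeZero.ne k
  omega

theorem eq_zero_of_zero_eq_one {k : ℕ} [NeZero k] (h : (0 : Fin k) = 1) (l : Fin k) : l = 0 := by
  have h1 : ((1 : Fin k) : ℕ) = 0 := by rw [← h]; rfl
  rw [Fin.val_one'] at h1
  have h2 := Nat.dvd_one.1 (Nat.dvd_of_mod_eq_zero h1)
  subst h2
  exact Subsingleton.elim _ _

theorem IsAnticlockwise.notMem_openArc (hx : IsAnticlockwise x) (l : Fin k) :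
    x l ∉ openArc (x 0) (x 1) := by
  by_cases h01 : (0 : Fin k) = 1
  · rw [eq_zero_of_zero_eq_one h01 l]
    exact fun h => (mem_openArc.1 h).1 rfl
  · rw [mem_openArc_of_ne (hx.1.ne h01)]
    exact hx.not_sbtw_succ (by rw [val_one_of_ne h01]; simp) l

variable (hxG : Set.range x = MulAction.orbit G (x 0))
include hxG

theorem exists_apply_eq (i : Fin k) : ∃ q ∈ G, q (x 0) = x i := by
  have : x i ∈ MulAction.orbit G (x 0) := hxG ▸ Set.mem_range_self i
  obtain ⟨q, hq⟩ := this
  exact ⟨q, q.2, hq⟩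

theorem exists_eq_apply {f : UnitAddCircle ≃ₜ UnitAddCircle} (hf : f ∈ G) (i : Fin k) :
    ∃ j, f (x i) = x j := by
  obtain ⟨q, hq, hqi⟩ := exists_apply_eq hxG i
  have : f (x i) ∈ Set.range x := by
    rw [hxG, ← hqi]
    exact ⟨⟨f * q, G.mul_mem hf hq⟩, rfl⟩
  obtain ⟨j, hj⟩ := this
  exact ⟨j, hj.symm⟩

theorem apply_eq_self_of_apply_zero (hcomm : ∀ f ∈ G, ∀ g ∈ G, f * g = g * f)
    {f : UnitAddCircle ≃ₜ UnitAddCircle} (hf : f ∈ G) (h0 : f (x 0) = x 0) (i : Fin k) :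
    f (x i) = x i := by
  obtain ⟨q, hq, hqi⟩ := exists_apply_eq hxG i
  rw [← hqi]
  have := DFunLike.congr_fun (hcomm f hf q hq) (x 0)
  exact this.trans (congrArg q h0)

/-- The arc and its image share the point `f y`, and neither contains an endpoint of the other
because `f` permutes the orbit and the arc contains no orbit point. So the two arcs have the same
initial point. -/
theorem apply_zero_of_mem_openArc (hG : G ≤ homeoPlus) (hx : IsAnticlockwise x)
    {f : UnitAddCircle ≃ₜ UnitAddCircle} (hf : f ∈ G) {y : UnitAddCircle}
    (hy : y ∈ openArc (x 0) (x 1)) (hfy : f y ∈ openArc (x 0) (x 1)) : f (x 0) = x 0 := by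
  by_cases h01 : (0 : Fin k) = 1
  · obtain ⟨j, hj⟩ := exists_eq_apply hxG hf 0
    rw [hj, eq_zero_of_zero_eq_one h01 j]
  · have hne := hx.1.ne h01
    obtain ⟨j, hj⟩ := exists_eq_apply hxG hf 0
    obtain ⟨l, hl⟩ := exists_eq_apply hxG (G.inv_mem hf) 0
    have hl' : x 0 = f (x l) := by
      rw [← hl]; exact (f.apply_symm_apply _).symm
    refine eq_of_mem_openArc hne (f.injective.ne hne) hfy ((apply_mem_openArc (hG hf)).2 hy) ?_ ?_
    · rw [hj]; exact hx.notMem_openArc j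
    · intro h
      have h' : f (x l) ∈ openArc (f (x 0)) (f (x 1)) := by rw [← hl']; exact h
      exact hx.notMem_openArc l ((apply_mem_openArc (hG hf)).1 h')

theorem apply_eq_succ (hG : G ≤ homeoPlus) (hx : IsAnticlockwise x)
    {g : UnitAddCircle ≃ₜ UnitAddCircle} (hg : g ∈ G) (h0 : g (x 0) = x 1) :
    ∀ (i : ℕ) (hi : i + 1 < k), g (x ⟨i, by omega⟩) = x ⟨i + 1, hi⟩ := by
  intro i
  induction i with
  | zero =>
    intro hi
    have e0 : (⟨0, by omega⟩ : Fin k) = 0 := rfl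
    have e1 : (⟨0 + 1, hi⟩ : Fin k) = 1 := by
      rw [Fin.ext_iff, Fin.val_one', Nat.mod_eq_of_lt (by omega)]
    rw [e0, e1, h0]
  | succ i ih =>
    intro hi
    have ih := ih (by omega)
    obtain ⟨j, hj⟩ := exists_eq_apply hxG hg ⟨i + 1, by omega⟩
    rw [hj]
    -- Gaps of the orbit go to gaps, so `x j` must be the next orbit point.
    have hgap : ∀ l, ¬ sbtw (x ⟨i + 1, by omega⟩) (x l) (x j) := by
      intro l hl
      obtain ⟨m, hm⟩ := exists_eq_apply hxG (G.inv_mem hg) l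
      have hm' : x l = g (x m) := by
        rw [← hm]; exact (g.apply_symm_apply _).symm
      have hl' : sbtw (g (x ⟨i, by omega⟩)) (g (x m)) (g (x ⟨i + 1, by omega⟩)) := by
        rw [ih, hj, ← hm']; exact hl
      exact hx.not_sbtw_succ rfl m ((hG hg _ _ _).1 hl')
    have hj1 : (j : ℕ) ≠ i + 1 := by
      intro e
      have e' : j = ⟨i + 1, by omega⟩ := Fin.ext e
      rw [e'] at hj
      have := congrArg Fin.val (hx.1 (g.injective (hj.trans ih.symm)))
      simp at this
    by_contra hne
    have hj2 : (j : ℕ) ≠ i + 1 + 1 := fun e => hne (congrArg x (Fin.ext e))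
    apply hgap ⟨i + 1 + 1, hi⟩
    rcases lt_or_gt_of_ne hj1 with h | h
    · exact (hx.2 j ⟨i + 1, by omega⟩ ⟨i + 1 + 1, hi⟩ h (by simp [Fin.lt_def])).cyclic_left
    · exact hx.2 ⟨i + 1, by omega⟩ ⟨i + 1 + 1, hi⟩ j (by simp [Fin.lt_def])
        (by rw [Fin.lt_def]; simp only; omega)

theorem pow_apply_zero (hG : G ≤ homeoPlus) (hx : IsAnticlockwise x)
    {g : UnitAddCircle ≃ₜ UnitAddCircle} (hg : g ∈ G) (h0 : g (x 0) = x 1) :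
    ∀ (i : ℕ) (hi : i < k), (g ^ i) (x 0) = x ⟨i, hi⟩ := by
  intro i
  induction i with
  | zero => intro hi; rfl
  | succ i ih =>
    intro hi
    rw [pow_succ']
    exact (congrArg g (ih (by omega))).trans (apply_eq_succ hxG hG hx hg h0 i hi)

/-- Were the value `x j` with `j > 0`, cancelling one `g` would identify the distinct points with
indices `k - 1` and `j - 1`. -/
theorem pow_card_apply_zero (hG : G ≤ homeoPlus) (hx : IsAnticlockwise x)
    {g : UnitAddCircle ≃ₜ UnitAddCircle} (hg : g ∈ G) (h0 : g (x 0) = x 1) :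
    (g ^ k) (x 0) = x 0 := by
  have hk := Nat.pos_of_ne_zero (NeZero.ne k)
  obtain ⟨⟨j, hj⟩, hjx⟩ := exists_eq_apply hxG (G.pow_mem hg k) 0
  rw [hjx]
  rcases j with _ | j
  · rfl
  · exfalso
    rw [← pow_apply_zero hxG hG hx hg h0 (j + 1) hj] at hjx
    obtain ⟨m, rfl⟩ : ∃ m, k = m + 1 := ⟨k - 1, by omega⟩
    rw [pow_succ', pow_succ'] at hjx
    have h1 : (g ^ m) (x 0) = (g ^ j) (x 0) := g.injective hjx
    rw [pow_apply_zero hxG hG hx hg h0 m (by omega),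
      pow_apply_zero hxG hG hx hg h0 j (by omega)] at h1
    have := congrArg Fin.val (hx.1 h1)
    simp at this
    omega

end FiniteOrbit

/-! ### Passing dynamical properties to an invariant open set -/

section Restriction

variable {X : Type*} [TopologicalSpace X]

theorem isTopologicallyTransitive_iff {G : Subgroup (X ≃ₜ X)} :
    MulAction.IsTopologicallyTransitive G X ↔ ∀ U V : Set X, IsOpen U → U.Nonempty → IsOpen V →
      V.Nonempty → ∃ g ∈ G, ∃ u ∈ U, g u ∈ V := by
  rw [MulAction.isTopologicallyTransitive_iff]
  constructor
  · intro h U V hU hU' hV hV'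
    obtain ⟨g, z, ⟨u, hu, rfl⟩, hz⟩ := h hU hU' hV hV'
    exact ⟨g, g.2, u, hu, hz⟩
  · intro h U V hU hU' hV hV'
    obtain ⟨g, hg, u, hu, hz⟩ := h U V hU hU' hV hV'
    exact ⟨⟨g, hg⟩, g u, ⟨u, hu, rfl⟩, hz⟩

/-- The restriction homomorphism to an invariant set. -/
def restrictHom (H : Subgroup (X ≃ₜ X)) (A : Set X) (hA : ∀ h ∈ H, ∀ a, a ∈ A ↔ h a ∈ A) :
    H →* restriction H A where
  toFun h := ⟨(h : X ≃ₜ X).subtype (hA h h.2), h, h.2, fun _ => rfl⟩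
  map_one' := rfl
  map_mul' _ _ := rfl

theorem restrictHom_surjective {H : Subgroup (X ≃ₜ X)} {A : Set X}
    (hA : ∀ h ∈ H, ∀ a, a ∈ A ↔ h a ∈ A) : Function.Surjective (restrictHom H A hA) := by
  rintro ⟨ψ, h, hh, hψ⟩
  exact ⟨⟨h, hh⟩, Subtype.ext (Homeomorph.ext fun a => Subtype.ext (hψ a).symm)⟩

/-- If an element of `G` that maps a point of the open set `A` into `A` belongs to `H`, then
topological transitivity passes from `G` to the restriction of `H` to `A`. -/
theorem isTopologicallyTransitive_restriction {G H : Subgroup (X ≃ₜ X)} {A : Set X}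
    (hA : ∀ h ∈ H, ∀ a, a ∈ A ↔ h a ∈ A) (hAo : IsOpen A)
    (hret : ∀ g ∈ G, ∀ a ∈ A, g a ∈ A → g ∈ H) (hG : MulAction.IsTopologicallyTransitive G X) :
    MulAction.IsTopologicallyTransitive (restriction H A) A := by
  rw [isTopologicallyTransitive_iff] at hG ⊢
  intro U V hU hU' hV hV'
  obtain ⟨g, hg, _, ⟨u, hu, rfl⟩, v, hv, huv⟩ := hG _ _ (hAo.isOpenMap_subtype_val U hU)
    (hU'.image _) (hAo.isOpenMap_subtype_val V hV) (hV'.image _)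
  have hgH := hret g hg u u.2 (huv ▸ v.2)
  refine ⟨_, (restrictHom H A hA ⟨g, hgH⟩).2, u, hu, ?_⟩
  have : (restrictHom H A hA ⟨g, hgH⟩ : A ≃ₜ A) u = v := Subtype.ext huv.symm
  rwa [this]

theorem isAlmostMinimal_restriction {G H : Subgroup (X ≃ₜ X)} {A : Set X}
    (hA : ∀ h ∈ H, ∀ a, a ∈ A ↔ h a ∈ A) (hAo : IsOpen A)
    (hret : ∀ g ∈ G, ∀ a ∈ A, g a ∈ A → g ∈ H) (hG : IsAlmostMinimal G) :
    IsAlmostMinimal (restriction H A) := by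
  have hC := Set.Countable.preimage_of_injOn hG (Subtype.val_injective (p := (· ∈ A))).injOn
  -- Every visit of the `G`-orbit of `a` to `A` is made by an element of `H`, so density in `X`
  -- gives density in `A`.
  refine hC.mono fun a ha (hd : Dense (MulAction.orbit G (a : X))) => ha ?_
  rw [dense_iff_inter_open]
  intro U hU hU'
  obtain ⟨_, ⟨u, hu, rfl⟩, g, hgu⟩ :=
    hd.inter_open_nonempty _ (hAo.isOpenMap_subtype_val U hU) (hU'.image _)
  have hgu' : (g : X ≃ₜ X) a = u := hgu
  have hgH := hret g g.2 a a.2 (hgu' ▸ u.2)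
  exact ⟨u, hu, restrictHom H A hA ⟨g, hgH⟩, Subtype.ext hgu'⟩

end Restriction

theorem exists_isLUB_Ioo {a b : ℝ} (s : Set (Set.Ioo a b)) (hs : s.Nonempty) (hb : BddAbove s) :
    ∃ m, IsLUB s m := by
  obtain ⟨w, hw⟩ := hs
  obtain ⟨u, hu⟩ := hb
  have h1 : IsLUB (Subtype.val '' s) (sSup (Subtype.val '' s)) :=
    isLUB_csSup ⟨w, w, hw, rfl⟩ ⟨u, by rintro _ ⟨z, hz, rfl⟩; exact hu hz⟩
  refine ⟨⟨sSup (Subtype.val '' s), w.2.1.trans_le (h1.1 ⟨w, hw, rfl⟩),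
    (h1.2 (by rintro _ ⟨z, hz, rfl⟩; exact hu hz : (u : ℝ) ∈ _)).trans_lt u.2.2⟩, ?_, ?_⟩
  · exact fun z hz => h1.1 ⟨z, hz, rfl⟩
  · intro z hz
    exact h1.2 (by rintro _ ⟨y, hy, rfl⟩; exact hz hy)

theorem lt_of_coe_eq_apply {h : UnitAddCircle ≃ₜ UnitAddCircle} (hh : h ∈ homeoPlus) {a : ℝ}
    (ha : h a = a) {w₁ w₂ y₁ y₂ : ℝ} (hw₁ : w₁ ∈ Set.Ioo a (a + 1)) (hw₂ : w₂ ∈ Set.Ioo a (a + 1))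
    (hy₁ : y₁ ∈ Set.Ioo a (a + 1)) (hy₂ : y₂ ∈ Set.Ioo a (a + 1)) (hw : w₁ < w₂)
    (h₁ : (y₁ : UnitAddCircle) = h w₁) (h₂ : (y₂ : UnitAddCircle) = h w₂) : y₁ < y₂ := by
  rw [← sbtw_coe hy₁ hy₂, h₁, h₂]
  conv => arg 1; rw [← ha]
  rw [hh]
  exact (sbtw_coe hw₁ hw₂).2 hw

/-- A finite set that meets the arc is not invariant under a topologically transitive group whose
returns to the arc fix the initial point of the arc. -/
theorem not_finite_invariant {G : Subgroup (UnitAddCircle ≃ₜ UnitAddCircle)} (hG : G ≤ homeoPlus)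
    (hGT : MulAction.IsTopologicallyTransitive G UnitAddCircle) {p q : UnitAddCircle}
    (hret : ∀ f ∈ G, ∀ z ∈ openArc p q, f z ∈ openArc p q →
      f p = p ∧ ∀ y, y ∈ openArc p q ↔ f y ∈ openArc p q)
    {B : Set UnitAddCircle} (hB : B.Finite) {z : UnitAddCircle} (hzB : z ∈ B)
    (hzA : z ∈ openArc p q) : ¬ ∀ f ∈ G, ∀ y ∈ B, f y ∈ B := by
  intro hinv
  obtain ⟨a, b, hab, hb, rfl, rfl⟩ := exists_chart_endpoints p q
  rw [openArc_eq_image hab hb] at hret hzA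
  have hI : ∀ t ∈ Set.Ioo a b, t ∈ Set.Ioo a (a + 1) := fun t ht => ⟨ht.1, ht.2.trans_le hb⟩
  have hfin : {t : ℝ | t ∈ Set.Ioo a b ∧ (t : UnitAddCircle) ∈ B}.Finite := by
    refine Set.Finite.of_finite_image (hB.subset ?_) (f := fun t : ℝ => (t : UnitAddCircle)) ?_
    · rintro _ ⟨t, ht, rfl⟩; exact ht.2
    · exact (coe_injOn a).mono fun t ht => Set.Ioo_subset_Ico_self (hI t ht.1)
  obtain ⟨s, hs, rfl⟩ := hzA
  -- A return map taking a point below the largest point `m` to one above it sends `m` higher still,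
  -- yet keeps it in `B` and in the arc.
  obtain ⟨m, ⟨hm, hmB⟩, hmax⟩ := Set.exists_max_image _ id hfin ⟨s, hs, hzB⟩
  obtain ⟨f, hf, _, ⟨u, hu, rfl⟩, v, hv, hvu⟩ := isTopologicallyTransitive_iff.1 hGT _ _
    (QuotientAddGroup.isOpenMap_coe _ (isOpen_Ioo (a := a) (b := m)))
    ((Set.nonempty_Ioo.2 hm.1).image _)
    (QuotientAddGroup.isOpenMap_coe _ (isOpen_Ioo (a := m) (b := b)))
    ((Set.nonempty_Ioo.2 hm.2).image _)
  have hu' : u ∈ Set.Ioo a b := ⟨hu.1, hu.2.trans hm.2⟩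
  have hv' : v ∈ Set.Ioo a b := ⟨hm.1.trans hv.1, hv.2⟩
  obtain ⟨hfa, hfA⟩ := hret f hf _ ⟨u, hu', rfl⟩ ⟨v, hv', hvu⟩
  obtain ⟨y, hy, hyf⟩ := (hfA m).1 ⟨m, hm, rfl⟩
  have hvy := lt_of_coe_eq_apply (hG hf) hfa (hI u hu') (hI m hm) (hI v hv') (hI y hy) hu.2 hvu hyf
  have hyB : (y : UnitAddCircle) ∈ B := by
    rw [show (y : UnitAddCircle) = f m from hyf]; exact hinv f hf _ hmB
  exact absurd (hv.1.trans hvy) (hmax y ⟨hy, hyB⟩).not_gt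

/-! ### The quotient, the arc and the finite orbits -/

section Main

variable {G : Subgroup (UnitAddCircle ≃ₜ UnitAddCircle)} {k : ℕ} [NeZero k]
  {x : Fin k → UnitAddCircle} (hG : G ≤ homeoPlus)
  (hxG : Set.range x = MulAction.orbit G (x 0))

include hG hxG

theorem exists_apply_mem_openArc (hx : IsAnticlockwise x) {y : UnitAddCircle}
    (hy : y ∉ Set.range x) : ∃ q ∈ G, q y ∈ openArc (x 0) (x 1) := by
  obtain ⟨g, hg, h0⟩ := exists_apply_eq hxG 1
  have hyx : ∀ i, y ≠ x i := fun i e => hy ⟨i, e.symm⟩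
  -- `x i` is the last orbit point met before `y` when starting from `x 0`; `g ^ i` carries the
  -- first arc to the one starting there. The final arc, `i + 1 = k`, closes up at `x 0`.
  obtain ⟨i, hi, hmax⟩ := Set.exists_max_image {i : Fin k | i = 0 ∨ sbtw (x 0) (x i) y} id
    (Set.toFinite _) ⟨0, Or.inl rfl⟩
  refine ⟨(g ^ (i : ℕ))⁻¹, G.inv_mem (G.pow_mem hg _), ?_⟩
  rw [← apply_mem_openArc (hG (G.pow_mem hg i))]
  have e1 : (g ^ (i : ℕ)) ((g ^ (i : ℕ))⁻¹ y) = y := (g ^ (i : ℕ)).apply_symm_apply y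
  have e2 : (g ^ (i : ℕ)) (x 1) = (g ^ ((i : ℕ) + 1)) (x 0) := by
    rw [pow_succ, ← h0]; rfl
  rw [e1, e2, pow_apply_zero hxG hG hx hg h0 i i.2]
  by_cases hik : (i : ℕ) + 1 < k
  · rw [pow_apply_zero hxG hG hx hg h0 _ hik]
    set j : Fin k := ⟨(i : ℕ) + 1, hik⟩ with hj
    have hij : i < j := Nat.lt_succ_self (i : ℕ)
    have hj0 : j ≠ 0 := (lt_of_le_of_lt (Fin.zero_le i) hij).ne'
    have hnot : ¬ sbtw (x 0) (x j) y := fun h => absurd (hmax j (Or.inr h)) hij.not_ge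
    have hyj : sbtw (x 0) y (x j) :=
      ((sbtw_or_sbtw (hx.1.ne hj0.symm) (hyx j).symm (hyx 0)).resolve_left hnot).cyclic_right
    rw [Fin.eta, mem_openArc_of_ne (hx.1.ne hij.ne)]
    rcases hi with rfl | hi
    · exact hyj
    · exact sbtw_of_sbtw_of_sbtw hi hyj
  · have hk : (i : ℕ) + 1 = k := by omega
    rw [hk, pow_card_apply_zero hxG hG hx hg h0, mem_openArc]
    refine ⟨hyx _, hyx _, ?_⟩
    rcases hi with h | hi
    · exact Or.inl (congrArg x h)
    · exact Or.inr hi.cyclic_left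

variable {H : Subgroup (UnitAddCircle ≃ₜ UnitAddCircle)}
  (hH : ∀ f, f ∈ H ↔ f ∈ G ∧ f (x 0) = x 0)
include hH

theorem exists_quotient_equiv (hx : IsAnticlockwise x) [(H.subgroupOf G).Normal] :
    Nonempty ((G ⧸ H.subgroupOf G) ≃* Multiplicative (ZMod k)) := by
  obtain ⟨g, hg, h0⟩ := exists_apply_eq hxG 1
  have hst : H.subgroupOf G = MulAction.stabilizer G (x 0) := by
    ext f
    rw [Subgroup.mem_subgroupOf, hH, MulAction.mem_stabilizer_iff]
    exact and_iff_right f.2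
  have hcard : Nat.card (G ⧸ H.subgroupOf G) = k := by
    rw [hst, ← Nat.card_congr (MulAction.orbitEquivQuotientStabilizer G (x 0)), ← hxG,
      Nat.card_range_of_injective hx.1, Nat.card_eq_fintype_card, Fintype.card_fin]
  have hcyc : IsCyclic (G ⧸ H.subgroupOf G) := by
    refine ⟨QuotientGroup.mk ⟨g, hg⟩, fun q => ?_⟩
    obtain ⟨f, rfl⟩ := QuotientGroup.mk_surjective q
    obtain ⟨i, hi⟩ := exists_eq_apply hxG f.2 0
    refine ⟨(i : ℕ), ?_⟩
    change ((⟨g, hg⟩ : G) : G ⧸ H.subgroupOf G) ^ ((i : ℕ) : ℤ) = (f : G ⧸ H.subgroupOf G)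
    rw [zpow_natCast, ← QuotientGroup.mk_pow, QuotientGroup.eq, hst, MulAction.mem_stabilizer_iff,
      mul_smul, inv_smul_eq_iff]
    exact hi.trans (pow_apply_zero hxG hG hx hg h0 i i.2).symm
  exact ⟨(hcard ▸ zmodCyclicMulEquiv hcyc).symm⟩

end Main

/-- The restriction of the stabilizer to the arc is tightly transitive. -/
theorem isTightlyTransitive_restriction {n : ℕ}
    {G H : Subgroup (UnitAddCircle ≃ₜ UnitAddCircle)} (hG : G ≤ homeoPlus)
    (e : G ≃* Multiplicative (Fin n → ℤ)) (hGt : IsTightlyTransitive G)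
    {p q : UnitAddCircle} (hH : ∀ f, f ∈ H ↔ f ∈ G ∧ f p = p)
    (hA : ∀ h ∈ H, ∀ z, z ∈ openArc p q ↔ h z ∈ openArc p q)
    (hret : ∀ f ∈ G, ∀ z ∈ openArc p q, f z ∈ openArc p q → f ∈ H)
    {g : UnitAddCircle ≃ₜ UnitAddCircle} {k : ℕ} (hk : k ≠ 0) (hg : g ∈ G)
    (hgk : (g ^ k) p = p) (hgen : ∀ f ∈ G, ∃ m : ℤ, f p = (g ^ m) p) :
    IsTightlyTransitive (restriction H (openArc p q)) := by
  refine ⟨isTopologicallyTransitive_restriction hA (isOpen_openArc p q) hret hGt.1, ?_⟩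
  intro F' hF' hF'0 hF'T
  rw [isTopologicallyTransitive_iff] at hF'T
  have hGT := isTopologicallyTransitive_iff.1 hGt.1
  let ψ : Multiplicative (Fin n → ℤ) → (UnitAddCircle ≃ₜ UnitAddCircle) := fun v => e.symm v
  let φ : (Fin n → ℤ) → UnitAddCircle → UnitAddCircle := fun v => ψ (Multiplicative.ofAdd v)
  have hψG : ∀ v, ψ v ∈ G := fun v => (e.symm v).2
  have hψ : ∀ f (hf : f ∈ G), ψ (e ⟨f, hf⟩) = f := fun f hf => by simp [ψ]
  have hφ : ∀ f (hf : f ∈ G), φ (e ⟨f, hf⟩).toAdd = f := fun f hf =>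
    congrArg DFunLike.coe (hψ f hf)
  have hφ0 : ∀ z, φ 0 z = z := fun z => by
    have : e.symm (Multiplicative.ofAdd 0) = 1 := by simp
    simp only [φ, ψ, this]; rfl
  have hφa : ∀ u v z, φ (u + v) z = φ u (φ v z) := fun u v z => by
    simp only [φ, ψ, ofAdd_add, map_mul]; rfl
  have hφc : ∀ v, Continuous (φ v) := fun v => (ψ (Multiplicative.ofAdd v)).continuous
  have hφf : ∀ v, (∀ z, φ v z = z) → v = 0 := by
    intro v hv
    have h1 : e.symm (Multiplicative.ofAdd v) = 1 := Subtype.ext (Homeomorph.ext hv)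
    simpa using h1
  let HΓ : AddSubgroup (Fin n → ℤ) :=
    { carrier := {v | φ v p = p}
      zero_mem' := hφ0 p
      add_mem' := fun {u v} (hu : φ u p = p) (hv : φ v p = p) => by
        change φ (u + v) p = p
        rw [hφa, hv, hu]
      neg_mem' := fun {v} (hv : φ v p = p) => by
        change φ (-v) p = p
        conv_lhs => rw [← hv, ← hφa, neg_add_cancel, hφ0] }
  have hHΓ : ∀ v, v ∈ HΓ ↔ φ v p = p := fun _ => Iff.rfl
  have hψH : ∀ v : HΓ, ψ (Multiplicative.ofAdd (v : Fin n → ℤ)) ∈ H := fun v =>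
    (hH _).2 ⟨hψG _, v.2⟩
  -- Surjectivity of `r` is enough: the preimage of a subgroup keeps its index.
  let r : HΓ →+ Additive (restriction H (openArc p q)) :=
    AddMonoidHom.mk' (fun v => Additive.ofMul (restrictHom H _ hA ⟨_, hψH v⟩)) fun u v => by
      rw [← ofMul_mul, ← map_mul]
      congr 2
      exact Subtype.ext (Homeomorph.ext fun z => hφa u v z)
  have hr : Function.Surjective r := by
    intro y
    obtain ⟨⟨h, hh⟩, hy⟩ := restrictHom_surjective hA y.toMul
    have hh' := (hH h).1 hh
    refine ⟨⟨(e ⟨h, hh'.1⟩).toAdd, ?_⟩, ?_⟩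
    · rw [hHΓ, hφ]; exact hh'.2
    · change Additive.ofMul _ = y
      rw [← ofMul_toMul y, ← hy]
      congr 2
      exact Subtype.ext (hψ h hh'.1)
  let F : AddSubgroup HΓ :=
    (Subgroup.toAddSubgroup (F'.subgroupOf (restriction H (openArc p q)))).comap r
  have hF0 : F.index = 0 :=
    (AddSubgroup.index_comap_of_surjective _ hr).trans hF'0
  obtain ⟨a, b, hab, hb, rfl, rfl⟩ := exists_chart_endpoints p q
  have himg := openArc_eq_image hab hb
  let c : Set.Ioo a b → UnitAddCircle := fun w => ((w : ℝ) : UnitAddCircle)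
  have hcI : ∀ w : Set.Ioo a b, (w : ℝ) ∈ Set.Ioo a (a + 1) := fun w =>
    ⟨w.2.1, w.2.2.trans_le hb⟩
  have hc : Function.Injective c := fun w₁ w₂ h => Subtype.ext
    (coe_injOn a (Set.Ioo_subset_Ico_self (hcI w₁)) (Set.Ioo_subset_Ico_self (hcI w₂)) h)
  have hcc : Continuous c := continuous_quotient_mk'.comp continuous_subtype_val
  have hco : IsOpenMap c :=
    QuotientAddGroup.isOpenMap_coe.comp isOpen_Ioo.isOpenMap_subtype_val
  have hcA : ∀ w, c w ∈ openArc (a : UnitAddCircle) b := fun w => himg ▸ ⟨w, w.2, rfl⟩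
  have hAc : ∀ z ∈ openArc (a : UnitAddCircle) b, ∃ w, c w = z := by
    intro z hz
    rw [himg] at hz
    obtain ⟨s, hs, rfl⟩ := hz
    exact ⟨⟨s, hs⟩, rfl⟩
  have hstep : ∀ v ∈ HΓ, ∀ w, ∃ w', c w' = φ v (c w) := fun v hv w =>
    hAc _ ((hA _ (hψH ⟨v, hv⟩) _).1 (hcA w))
  have hmono : ∀ v ∈ HΓ, ∀ w₁ w₂ y₁ y₂, w₁ < w₂ → c y₁ = φ v (c w₁) → c y₂ = φ v (c w₂) →
      y₁ < y₂ := by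
    intro v hv w₁ w₂ y₁ y₂ hw h1 h2
    exact lt_of_coe_eq_apply (hG (hψG (Multiplicative.ofAdd v))) hv (hcI w₁) (hcI w₂) (hcI y₁)
      (hcI y₂) hw h1 h2
  have : Nonempty (Set.Ioo a b) := (Set.nonempty_Ioo.2 hab).to_subtype
  have hFT : ∀ a' b' c' d' : Set.Ioo a b, a' < b' → c' < d' → ∃ v ∈ F, ∃ x y, a' < x ∧ x < b' ∧
      c' < y ∧ y < d' ∧ c y = φ v (c x) := by
    intro a' b' c' d' hab' hcd'
    have hopen : ∀ s t : Set.Ioo a b, IsOpen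
        ((Subtype.val : openArc (a : UnitAddCircle) b → UnitAddCircle) ⁻¹' (c '' Set.Ioo s t)) :=
      fun s t => (hco _ isOpen_Ioo).preimage continuous_subtype_val
    have hne : ∀ s t : Set.Ioo a b, s < t →
        ((Subtype.val : openArc (a : UnitAddCircle) b → UnitAddCircle) ⁻¹'
          (c '' Set.Ioo s t)).Nonempty := by
      intro s t hst
      obtain ⟨w, hw⟩ := exists_between hst
      exact ⟨⟨c w, hcA w⟩, w, hw, rfl⟩
    obtain ⟨f, hf, u, ⟨w, hw, hwu⟩, y, hy, hyu⟩ :=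
      hF'T _ _ (hopen a' b') (hne _ _ hab') (hopen c' d') (hne _ _ hcd')
    obtain ⟨v, hv⟩ := hr (Additive.ofMul ⟨f, hF' hf⟩)
    have hvf : ((r v).toMul : openArc (a : UnitAddCircle) b ≃ₜ openArc (a : UnitAddCircle) b) = f :=
      by rw [hv]; rfl
    refine ⟨v, ?_, w, y, hw.1, hw.2, hy.1, hy.2, ?_⟩
    · change ((r v).toMul : openArc (a : UnitAddCircle) b ≃ₜ openArc (a : UnitAddCircle) b) ∈ F'
      rwa [hvf]
    · rw [hyu, ← hvf, hwu]; rfl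
  have hT : ∀ U V : Set UnitAddCircle, IsOpen U → U.Nonempty → IsOpen V → V.Nonempty →
      ∃ v, ∃ z ∈ U, φ v z ∈ V := by
    intro U V hU hU' hV hV'
    obtain ⟨f, hf, u, hu, hfu⟩ := hGT U V hU hU' hV hV'
    exact ⟨(e ⟨f, hf⟩).toAdd, u, hu, by rwa [hφ]⟩
  set γ : Fin n → ℤ := (e ⟨g, hg⟩).toAdd with hγ
  have hψm : ∀ m : ℤ, φ (m • γ) = (g ^ m : UnitAddCircle ≃ₜ UnitAddCircle) := by
    intro m
    have : m • γ = (e ⟨g ^ m, G.zpow_mem hg m⟩).toAdd := by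
      rw [hγ, ← toAdd_zpow, ← map_zpow]; rfl
    rw [this, hφ]
  obtain ⟨L, hL0, hLT⟩ := exists_infinite_index_transitive (g := γ) (k := k) hφ0 hφa hφc hφf hT hc
    hcc hco exists_isLUB_Ioo hstep hmono hF0 hFT (by exact_mod_cast hk)
    (by rw [hHΓ, hψm, zpow_natCast, hgk]) (fun v => by
      obtain ⟨m, hm⟩ := hgen (ψ (Multiplicative.ofAdd v)) (hψG _)
      refine ⟨m, ?_⟩
      rw [hHΓ, sub_eq_neg_add, hφa]
      change φ _ (ψ (Multiplicative.ofAdd v) a) = _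
      rw [hm, ← hψm, ← hφa, neg_add_cancel, hφ0])
  -- `L`, read back inside `G`, contradicts tightness.
  refine hGt.2 (((AddSubgroup.toSubgroup L).comap e.toMonoidHom).map G.subtype) ?_ ?_ ?_
  · rintro _ ⟨f, -, rfl⟩
    exact f.2
  · rw [Subgroup.relIndex, Subgroup.subgroupOf, Subgroup.comap_map_eq_self_of_injective
      G.subtype_injective, Subgroup.index_comap_of_surjective _ e.surjective]
    exact hL0
  · rw [isTopologicallyTransitive_iff]
    intro U V hU hU' hV hV'
    obtain ⟨v, hv, z, hz, hzV⟩ := hLT U V hU hU' hV hV'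
    refine ⟨ψ (Multiplicative.ofAdd v), ⟨e.symm (Multiplicative.ofAdd v), ?_, rfl⟩, z, hz, hzV⟩
    change e (e.symm _) ∈ AddSubgroup.toSubgroup L
    rw [e.apply_symm_apply]
    exact hv

end CircleGroups

theorem proposition5p1 (n : ℕ) (hn : 2 ≤ n)
    (G : Subgroup (UnitAddCircle ≃ₜ UnitAddCircle)) (hG : G ≤ CircleGroups.homeoPlus)
    (hGn : Nonempty (G ≃* Multiplicative (Fin n → ℤ)))
    (hGt : CircleGroups.IsTightlyTransitive G) (hGm : CircleGroups.IsAlmostMinimal G)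
    (k : ℕ) [NeZero k] (x : Fin k → UnitAddCircle) (hx : CircleGroups.IsAnticlockwise x)
    (hxG : Set.range x = MulAction.orbit G (x 0))
    (H : Subgroup (UnitAddCircle ≃ₜ UnitAddCircle))
    (hH : H = CircleGroups.pointwiseStabilizer G (Set.range x)) :
    (∃ _ : (H.subgroupOf G).Normal,
      Nonempty ((G ⧸ H.subgroupOf G) ≃* Multiplicative (ZMod k))) ∧
    (∀ h ∈ H, h '' CircleGroups.openArc (x 0) (x 1) = CircleGroups.openArc (x 0) (x 1)) ∧
    CircleGroups.IsTightlyTransitive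
      (CircleGroups.restriction H (CircleGroups.openArc (x 0) (x 1))) ∧
    CircleGroups.IsAlmostMinimal
      (CircleGroups.restriction H (CircleGroups.openArc (x 0) (x 1))) ∧
    (∀ y : UnitAddCircle, (MulAction.orbit G y).Finite → MulAction.orbit G y = Set.range x) := by
  have hcomm : ∀ f ∈ G, ∀ g ∈ G, f * g = g * f := by
    intro f hf g hg
    obtain ⟨e⟩ := hGn
    have h : (⟨f, hf⟩ * ⟨g, hg⟩ : G) = ⟨g, hg⟩ * ⟨f, hf⟩ :=
      e.injective (by rw [map_mul, map_mul, mul_comm])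
    exact congrArg Subtype.val h
  have hHiff : ∀ f, f ∈ H ↔ f ∈ G ∧ f (x 0) = x 0 := by
    intro f
    rw [hH, CircleGroups.pointwiseStabilizer, Subgroup.mem_inf, mem_fixingSubgroup_iff]
    refine and_congr_right fun hf => ⟨fun h => h _ ⟨0, rfl⟩, ?_⟩
    rintro h _ ⟨i, rfl⟩
    exact CircleGroups.apply_eq_self_of_apply_zero hxG hcomm hf h i
  have hA : ∀ h ∈ H, ∀ z, z ∈ CircleGroups.openArc (x 0) (x 1) ↔
      h z ∈ CircleGroups.openArc (x 0) (x 1) := by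
    intro h hh z
    obtain ⟨hhG, h0⟩ := (hHiff h).1 hh
    have h1 := CircleGroups.apply_eq_self_of_apply_zero hxG hcomm hhG h0 1
    have := CircleGroups.apply_mem_openArc (hG hhG) (p := x 0) (q := x 1) (z := z)
    rw [h0, h1] at this
    exact this.symm
  have hret : ∀ f ∈ G, ∀ z ∈ CircleGroups.openArc (x 0) (x 1),
      f z ∈ CircleGroups.openArc (x 0) (x 1) → f ∈ H := fun f hf z hz hfz =>
    (hHiff f).2 ⟨hf, CircleGroups.apply_zero_of_mem_openArc hxG hG hx hf hz hfz⟩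
  have hnormal : (H.subgroupOf G).Normal := by
    refine ⟨fun f hf g => ?_⟩
    have h : g * f = f * g := Subtype.ext (hcomm g g.2 f f.2)
    rwa [h, mul_inv_cancel_right]
  obtain ⟨g, hg, h0⟩ := CircleGroups.exists_apply_eq hxG 1
  refine ⟨⟨hnormal, CircleGroups.exists_quotient_equiv hG hxG hHiff hx⟩, ?_, ?_,
    CircleGroups.isAlmostMinimal_restriction hA (CircleGroups.isOpen_openArc _ _) hret hGm, ?_⟩
  · intro h hh
    ext z
    constructor
    · rintro ⟨y, hy, rfl⟩
      exact (hA h hh y).1 hy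
    · intro hz
      refine ⟨h.symm z, (hA h hh _).2 ?_, h.apply_symm_apply z⟩
      rwa [h.apply_symm_apply]
  · obtain ⟨e⟩ := hGn
    refine CircleGroups.isTightlyTransitive_restriction hG e hGt hHiff hA hret (NeZero.ne k) hg
      (CircleGroups.pow_card_apply_zero hxG hG hx hg h0) fun f hf => ?_
    obtain ⟨j, hj⟩ := CircleGroups.exists_eq_apply hxG hf 0
    refine ⟨(j : ℕ), ?_⟩
    rw [zpow_natCast, CircleGroups.pow_apply_zero hxG hG hx hg h0 j j.2]
    exact hj
  · intro y hy
    by_cases hyx : y ∈ Set.range x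
    · rw [hxG] at hyx ⊢
      exact MulAction.orbit_eq_iff.2 hyx
    · exfalso
      obtain ⟨q, hq, hqy⟩ := CircleGroups.exists_apply_mem_openArc hG hxG hx hyx
      refine CircleGroups.not_finite_invariant hG hGt.1 (fun f hf z hz hfz => ?_) hy
        (z := q y) ⟨⟨q, hq⟩, rfl⟩ hqy ?_
      · have hfH := hret f hf z hz hfz
        exact ⟨((hHiff f).1 hfH).2, hA f hfH⟩
      · rintro f hf _ ⟨r, rfl⟩
        exact ⟨⟨f, hf⟩ * r, rfl⟩
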